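/- Let $d\ge 1$ be an integer and let $p\ge 1$ be real. There is a constant $C>0$, depending only on $p$ and $d$, such that the following holds. Let $\mu$ be a Borel probability measure on $\mathbb R^d$, put $|x|=\max_i|x_i|$ and $H(t)=\mu(\{x\in\mathbb R^d:|x|>t\})$, let $n\ge 1$, let $X_1,\dots,X_n$ be i.i.d. random variables with law $\mu$, and let $\mu_n=\frac1n\sum_{k=1}^n\delta_{X_k}$. For probability measures $\nu_1,\nu_2$ on $\mathbb R^d$ let $$W_p^p(\nu_1,\nu_2)=\inf_{\pi}\int_{\mathbb R^d\times\mathbb R^d}|x-y|_2^p\,\pi(dx,dy),$$ where $|\cdot|_2$ is the Euclidean norm and $\pi$ runs over the probability measures on $\mathbb R^d\times\mathbb R^d$ with margins $\nu_1$ and $\nu_2$, and let $\|\cdot\|_2$ denote the $L^2$ norm of a random variable. If $\int_0^\infty t^{p-1}\sqrt{H(t)}\,dt<\infty$, then $W_p^p(\mu_n,\mu)$ is measurable (up to modification on a null set) and $$\left\|W_p^p(\mu_n,\mu)\right\|_2^2\le C\left(\int_0^\infty t^{p-1}\sqrt{H(t)}\,dt\right)^2\times\begin{cases}\dfrac1n&\text{if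 }p>d/2,\\[2mm]\dfrac{(\log n)^2}{n}&\text{if }p=d/2\text{ and }n\ge2,\\[2mm]\dfrac1{n^{2p/d}}&\text{if }p<d/2.\end{cases}$$ -/

import Mathlib

open MeasureTheory ProbabilityTheory Set
open scoped NNReal ENNReal

namespace EmpiricalWasserstein

noncomputable section

/-- The couplings of two probability measures: the probability measures on the product space
with margins `ν₁` and `ν₂`. -/
def couplings {d : ℕ} (ν₁ ν₂ : Measure (EuclideanSpace ℝ (Fin d))) :
    Set (Measure (EuclideanSpace ℝ (Fin d) × EuclideanSpace ℝ (Fin d))) :=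
  {π | IsProbabilityMeasure π ∧ π.fst = ν₁ ∧ π.snd = ν₂}

/-- The `p`-th power `W_p^p(ν₁, ν₂)` of the Wasserstein distance of order `p`, for the Euclidean
norm, with values in `[0, ∞]`. -/
def wassersteinPow {d : ℕ} (p : ℝ) (ν₁ ν₂ : Measure (EuclideanSpace ℝ (Fin d))) : ℝ≥0∞ :=
  ⨅ π ∈ couplings ν₁ ν₂, ∫⁻ z, ENNReal.ofReal (‖z.1 - z.2‖ ^ p) ∂π

/-- The empirical measure `(1/n) ∑ₖ δ_{xₖ}` of `n` points. -/
def empiricalMeasure {d n : ℕ} (x : Fin n → EuclideanSpace ℝ (Fin d)) :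
    Measure (EuclideanSpace ℝ (Fin d)) :=
  (n : ℝ≥0∞)⁻¹ • ∑ k, Measure.dirac (x k)

/-- The random variable `ω ↦ W_p^p(μ_n, μ)`, where `μ_n` is the empirical measure of the sample
`X_1(ω), …, X_n(ω)`. -/
def empiricalWassersteinPow {d n : ℕ} {Ω : Type*} (p : ℝ)
    (X : Fin n → Ω → EuclideanSpace ℝ (Fin d)) (μ : Measure (EuclideanSpace ℝ (Fin d)))
    (ω : Ω) : ℝ≥0∞ :=
  wassersteinPow p (empiricalMeasure fun k => X k ω) μ

/-- The tail `H(t) = μ{x : |x| > t}`, where `|x| = max_i |x_i|`: the norm of the underlying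
function `x.ofLp : Fin d → ℝ` is the sup norm. -/
def tail {d : ℕ} (μ : Measure (EuclideanSpace ℝ (Fin d))) (t : ℝ) : ℝ :=
  μ.real {x | t < ‖x.ofLp‖}

/-- The integral `∫₀^∞ t^{p-1} √H(t) dt`, with values in `[0, ∞]`. -/
def tailIntegral {d : ℕ} (p : ℝ) (μ : Measure (EuclideanSpace ℝ (Fin d))) : ℝ≥0∞ :=
  ∫⁻ t in Ioi (0 : ℝ), ENNReal.ofReal (t ^ (p - 1) * √(tail μ t))

end

end EmpiricalWasserstein

namespace EmpiricalWasserstein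

/-! Cut space into the origin and the dyadic shells `2^(m-1) < |x| ≤ 2^m`, and each shell, at level
`l`, into at most a constant times `2^(dl)` cells of diameter at most `√d * 2^(m-l)`. Match as much
mass of `μ_n` and `μ` as possible inside the finest cells, then the leftovers inside coarser and
coarser cells, and what remains at the end arbitrarily. Mass still unmatched after a level is
bounded by the discrepancy over the cells of that level. Refining indefinitely, `W_p^p(μ_n, μ)` is
at most a constant times `∑_l 2^(-pl) ∑_m 2^(pm) D_{l,m}`, where `D_{l,m}` sums `|μ_n(Q) - μ(Q)|`
over the cells of level `l` in shell `m` (`exists_coupling_of_nested`, `wassersteinPow_le`).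

The second moment of `D_{l,m}` is at most `4 μ(shell m) min(1, N_l / n)`, with `N_l` the number of
grid positions: the first bound is trivial, the second is Cauchy–Schwarz and the variance of an
empirical frequency (`lintegral_discrepancy_sq_le`). By Minkowski's inequality the `L²` norm is then
bounded by a product of a sum over levels and a sum over shells. The latter, `∑_m 2^(pm) √μ(shell
m)`, is a dyadic form of the tail integral (`tsum_weight_mul_sqrt_le`). The former behaves like `∑_l
2^(-pl) min(1, 2^(dl/2) / √n)`. Its terms before saturation are geometric of ratio `2^(d/2 - p)`, so
the first levels dominate, all levels up to order `log n` count equally, or the saturation level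
dominates: these are the three rates (`exists_rate_constant`).

Measurability comes from writing the cost as an infimum of upper semicontinuous functions of the
sample (`measurable_wassersteinPow_empiricalMeasure`). -/

/-- The absolute difference of two extended nonnegative numbers. -/
def absDiff (a b : ℝ≥0∞) : ℝ≥0∞ := (a - b) + (b - a)

theorem absDiff_add_right {a b t : ℝ≥0∞} (ht : t ≠ ∞) : absDiff (a + t) (b + t) = absDiff a b := by
  unfold absDiff
  rw [ENNReal.add_sub_add_eq_sub_right ht, ENNReal.add_sub_add_eq_sub_right ht]

/-! ### Couplings built from nested countable partitions. -/

section Partition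

variable {X J : Type*} [MeasurableSpace X] [Countable J] [MeasurableSpace J]
  [MeasurableSingletonClass J]

theorem lintegral_comp_label {q : X → J} (hq : Measurable q) (f : J → ℝ≥0∞) (α : Measure X) :
    ∫⁻ x, f (q x) ∂α = ∑' j, f j * α (q ⁻¹' {j}) := by
  rw [← lintegral_map (measurable_of_countable f) hq, lintegral_countable']
  simp_rw [Measure.map_apply hq (measurableSet_singleton _)]

theorem sum_restrict_label {q : X → J} (hq : Measurable q) (α : Measure X) :
    Measure.sum (fun j => α.restrict (q ⁻¹' {j})) = α := by
  have h := Measure.restrict_iUnion (μ := α) (s := fun j => q ⁻¹' {j})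
    (fun i j hij => Disjoint.preimage q (by simpa using hij))
    (fun j => hq (measurableSet_singleton j))
  rw [← h, ← preimage_iUnion, iUnion_of_singleton, preimage_univ, Measure.restrict_univ]

theorem sum_smul_restrict_add {q : X → J} (hq : Measurable q) (α : Measure X) {w : J → ℝ≥0∞}
    (hw : ∀ j, w j ≤ 1) :
    Measure.sum (fun j => w j • α.restrict (q ⁻¹' {j})) +
      Measure.sum (fun j => (1 - w j) • α.restrict (q ⁻¹' {j})) = α := by
  rw [Measure.sum_add_sum]
  conv_rhs => rw [← sum_restrict_label hq α]
  congr 1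
  ext1 j
  rw [← add_smul, add_tsub_cancel_of_le (hw j), one_smul]

omit [Countable J] in
theorem sum_smul_restrict_apply {q : X → J} (hq : Measurable q) (α : Measure X) (w : J → ℝ≥0∞)
    (j : J) :
    Measure.sum (fun i => w i • α.restrict (q ⁻¹' {i})) (q ⁻¹' {j}) = w j * α (q ⁻¹' {j}) := by
  rw [Measure.sum_apply _ (hq (measurableSet_singleton j)), tsum_eq_single j]
  · simp
  · intro i hij
    have : q ⁻¹' {j} ∩ q ⁻¹' {i} = ∅ := by
      rw [← preimage_inter]; simp [hij.symm]
    simp [Measure.restrict_apply (hq (measurableSet_singleton j)), this]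

/-- This is the mass left in a cell of mass `a` after matching it against mass `b`. -/
theorem one_sub_mul_eq_sub {a b : ℝ≥0∞} (ha : a ≠ ∞) (hb' : b ≠ ∞) :
    (1 - (max a b)⁻¹ * b) * a = a - b := by
  rcases le_or_gt a b with h | h
  · rw [max_eq_right h, tsub_eq_zero_of_le h]
    rcases eq_or_ne b 0 with rfl | hb
    · simp_all
    · simp [ENNReal.inv_mul_cancel hb hb']
  · rw [max_eq_left h.le, ENNReal.sub_mul (by simp [ha]), one_mul, mul_right_comm,
      ENNReal.inv_mul_cancel (ne_bot_of_gt h) ha, one_mul]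

theorem inv_max_mul_le_one (a b : ℝ≥0∞) : (max a b)⁻¹ * b ≤ 1 := by
  rw [mul_comm, ← div_eq_mul_inv]
  exact ENNReal.div_le_of_le_mul (by rw [one_mul]; exact le_max_right _ _)

/-- On each cell of a countable partition one matches as much mass of `α` and `β` as possible. -/
theorem exists_partial_coupling {q : X → J} (hq : Measurable q) (α β : Measure X)
    [IsFiniteMeasure α] [IsFiniteMeasure β] :
    ∃ (π : Measure (X × X)) (α' β' : Measure X), π.fst + α' = α ∧ π.snd + β' = β ∧
      (∀ᵐ z ∂π, q z.1 = q z.2) ∧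
      (∀ j, α' (q ⁻¹' {j}) = α (q ⁻¹' {j}) - β (q ⁻¹' {j})) ∧
      ∀ j, β' (q ⁻¹' {j}) = β (q ⁻¹' {j}) - α (q ⁻¹' {j}) := by
  set Q : J → Set X := fun j => q ⁻¹' {j} with hQ
  -- Dividing the product measure by the larger of the two masses leaves total mass equal to the
  -- smaller one, the most that can be matched. If both masses vanish, `M j = ∞` multiplies a zero
  -- measure.
  set M : J → ℝ≥0∞ := fun j => (max (α (Q j)) (β (Q j)))⁻¹ with hM
  have hQm : ∀ j, MeasurableSet (Q j) := fun j => hq (measurableSet_singleton j)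
  have hw1 : ∀ j, M j * β (Q j) ≤ 1 := fun j => inv_max_mul_le_one _ _
  have hw2 : ∀ j, M j * α (Q j) ≤ 1 := fun j => by
    simp only [hM]; rw [max_comm]; exact inv_max_mul_le_one _ _
  refine ⟨Measure.sum fun j => M j • (α.restrict (Q j)).prod (β.restrict (Q j)),
    Measure.sum fun j => (1 - M j * β (Q j)) • α.restrict (Q j),
    Measure.sum fun j => (1 - M j * α (Q j)) • β.restrict (Q j), ?_, ?_, ?_, ?_, ?_⟩
  · have := sum_smul_restrict_add hq α hw1
    convert this using 2
    rw [Measure.fst, Measure.map_sum measurable_fst.aemeasurable]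
    congr 1
    ext1 j
    rw [Measure.map_smul, Measure.map_fst_prod, smul_smul, Measure.restrict_apply_univ]
  · have := sum_smul_restrict_add hq β hw2
    convert this using 2
    rw [Measure.snd, Measure.map_sum measurable_snd.aemeasurable]
    congr 1
    ext1 j
    rw [Measure.map_smul, Measure.map_snd_prod, smul_smul, Measure.restrict_apply_univ]
  · rw [Measure.ae_sum_iff]
    intro j
    refine Measure.ae_smul_measure ?_ _
    rw [Measure.prod_restrict]
    filter_upwards [ae_restrict_mem ((hQm j).prod (hQm j))] with z hz
    simp only [hQ, mem_prod, mem_preimage, mem_singleton_iff] at hz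
    rw [hz.1, hz.2]
  · intro j
    rw [sum_smul_restrict_apply hq]
    exact one_sub_mul_eq_sub (measure_ne_top _ _) (measure_ne_top _ _)
  · intro j
    rw [sum_smul_restrict_apply hq]
    simp only [hM]
    rw [max_comm]
    exact one_sub_mul_eq_sub (measure_ne_top _ _) (measure_ne_top _ _)

/-- The normalized product of two measures of equal finite mass, with cost controlled by the margins. -/
theorem exists_coupling_of_le_add {c : X × X → ℝ≥0∞} {f : X → ℝ≥0∞} (hf : Measurable f)
    (hc : ∀ x y, c (x, y) ≤ f x + f y) (α β : Measure X) [IsFiniteMeasure α] [IsFiniteMeasure β]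
    (h : α univ = β univ) :
    ∃ π : Measure (X × X), π.fst = α ∧ π.snd = β ∧
      ∫⁻ z, c z ∂π ≤ ∫⁻ x, f x ∂α + ∫⁻ x, f x ∂β := by
  -- For zero mass the factor is `∞ * 0 = 0`, which is harmless since `γ` is then zero.
  have key : ∀ γ : Measure X, γ univ = β univ → ((β univ)⁻¹ * β univ) • γ = γ := by
    intro γ hγ
    rcases eq_or_ne (β univ) 0 with h0 | h0
    · rw [h0, Measure.measure_univ_eq_zero] at hγ
      simp [hγ]
    · rw [ENNReal.inv_mul_cancel h0 (measure_ne_top _ _), one_smul]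
  have h1 : ((β univ)⁻¹ • α.prod β).fst = α := by
    rw [Measure.fst, Measure.map_smul, Measure.map_fst_prod, smul_smul, key α h]
  have h2 : ((β univ)⁻¹ • α.prod β).snd = β := by
    rw [Measure.snd, Measure.map_smul, Measure.map_snd_prod, smul_smul, h, key β rfl]
  refine ⟨_, h1, h2, ?_⟩
  calc _ ≤ ∫⁻ z, f z.1 + f z.2 ∂((β univ)⁻¹ • α.prod β) :=
        lintegral_mono fun z => hc z.1 z.2
    _ = ∫⁻ x, f x ∂((β univ)⁻¹ • α.prod β).fst + ∫⁻ x, f x ∂((β univ)⁻¹ • α.prod β).snd := by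
        rw [lintegral_add_left (by fun_prop), Measure.fst, Measure.snd,
          lintegral_map hf measurable_fst, lintegral_map hf measurable_snd]
    _ = _ := by rw [h1, h2]

/-- Coupling along a sequence of nested partitions, from the finest to the coarsest. -/
theorem exists_coupling_of_nested {c : X × X → ℝ≥0∞} {q : ℕ → X → J} (hq : ∀ l, Measurable (q l))
    {g : J → J} (hg : ∀ l x, q l x = g (q (l + 1) x)) {D : ℕ → J → ℝ≥0∞}
    (hD : ∀ l x y, q l x = q l y → c (x, y) ≤ D l (q l y)) {E : J → ℝ≥0∞}
    (hE : ∀ x y, c (x, y) ≤ E (q 0 x) + E (q 0 y)) (L : ℕ) :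
    ∀ (α β : Measure X) [IsFiniteMeasure α] [IsFiniteMeasure β], α univ = β univ →
    ∃ π : Measure (X × X), π.fst = α ∧ π.snd = β ∧
      ∫⁻ z, c z ∂π ≤ ∑' j, D L j * β (q L ⁻¹' {j}) +
        ∑ l ∈ Finset.range L, ∑' j, D l (g j) *
          absDiff (α (q (l + 1) ⁻¹' {j})) (β (q (l + 1) ⁻¹' {j})) +
        ∑' j, E j * absDiff (α (q 0 ⁻¹' {j})) (β (q 0 ⁻¹' {j})) := by
  have coarsen : ∀ L x y, q L x = q L y → ∀ l ≤ L, q l x = q l y := by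
    intro L
    induction L with
    | zero => intro x y h l hl; obtain rfl : l = 0 := by omega
              exact h
    | succ L ih =>
      intro x y h l hl
      rcases Nat.lt_or_eq_of_le hl with h' | rfl
      · exact ih x y (by rw [hg, hg L y, h]) l (by omega)
      · exact h
  -- One round of matching: any coupling of the leftovers extends to a coupling of `α` and `β`, at
  -- the extra cost of moving inside cells of level `L`. The leftovers keep the discrepancies of all
  -- coarser levels, so the induction can continue with them.
  have match_level : ∀ (L : ℕ) (α β : Measure X) [IsFiniteMeasure α] [IsFiniteMeasure β],
      α univ = β univ → ∃ α' β' : Measure X, IsFiniteMeasure α' ∧ IsFiniteMeasure β' ∧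
        α' univ = β' univ ∧
        (∀ j, α' (q L ⁻¹' {j}) = α (q L ⁻¹' {j}) - β (q L ⁻¹' {j})) ∧
        (∀ j, β' (q L ⁻¹' {j}) = β (q L ⁻¹' {j}) - α (q L ⁻¹' {j})) ∧
        (∀ l ≤ L, ∀ j, absDiff (α' (q l ⁻¹' {j})) (β' (q l ⁻¹' {j})) =
          absDiff (α (q l ⁻¹' {j})) (β (q l ⁻¹' {j}))) ∧
        ∀ R : ℝ≥0∞, (∃ π : Measure (X × X), π.fst = α' ∧ π.snd = β' ∧ ∫⁻ z, c z ∂π ≤ R) →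
          ∃ π : Measure (X × X), π.fst = α ∧ π.snd = β ∧
            ∫⁻ z, c z ∂π ≤ ∑' j, D L j * β (q L ⁻¹' {j}) + R := by
    intro L α β _ _ h
    obtain ⟨π, α', β', h1, h2, h3, h6, h5⟩ := exists_partial_coupling (hq L) α β
    have hα' : α' ≤ α := h1 ▸ Measure.le_add_left le_rfl
    have hβ' : β' ≤ β := h2 ▸ Measure.le_add_left le_rfl
    have hπ : π.fst ≤ α := by
      conv_rhs => rw [← h1]
      exact Measure.le_add_right le_rfl
    have hπ2 : π.snd ≤ β := by
      conv_rhs => rw [← h2]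
      exact Measure.le_add_right le_rfl
    have hfin : IsFiniteMeasure π.fst := isFiniteMeasure_of_le α hπ
    -- The matched pairs share their level `L` cell, hence every coarser cell; removing them takes
    -- the same mass from `α` and `β` in each such cell.
    have hcell : ∀ l ≤ L, ∀ j, π.fst (q l ⁻¹' {j}) = π.snd (q l ⁻¹' {j}) := by
      intro l hl j
      have hm := hq l (measurableSet_singleton j)
      rw [Measure.fst_apply hm, Measure.snd_apply hm]
      refine measure_congr ?_
      filter_upwards [h3] with z hz
      have := coarsen L z.1 z.2 hz l hl
      change (q l z.1 = j) = (q l z.2 = j)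
      rw [this]
    refine ⟨α', β', isFiniteMeasure_of_le α hα', isFiniteMeasure_of_le β hβ', ?_, h6, h5, ?_, ?_⟩
    · have e : π.fst univ = π.snd univ := by rw [Measure.fst_univ, Measure.snd_univ]
      rw [← h1, ← h2, Measure.add_apply, Measure.add_apply, ← e] at h
      exact (ENNReal.add_right_inj (measure_ne_top _ _)).1 h
    · intro l hl j
      conv_rhs => rw [← h1, ← h2, Measure.add_apply, Measure.add_apply, ← hcell l hl j,
        add_comm, add_comm (π.fst _), absDiff_add_right (measure_ne_top _ _)]
    · rintro R ⟨π', h1', h2', h3'⟩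
      refine ⟨π + π', ?_, ?_, ?_⟩
      · rw [← h1, ← h1', Measure.fst, Measure.map_add _ _ measurable_fst]; rfl
      · rw [← h2, ← h2', Measure.snd, Measure.map_add _ _ measurable_snd]; rfl
      · rw [lintegral_add_measure]
        refine add_le_add ?_ h3'
        have hDm : Measurable (D L) := measurable_of_countable _
        calc ∫⁻ z, c z ∂π ≤ ∫⁻ z, D L (q L z.2) ∂π := by
              refine lintegral_mono_ae ?_
              filter_upwards [h3] with z hz using hD L z.1 z.2 hz
          _ = ∫⁻ y, D L (q L y) ∂π.snd := by
              rw [Measure.snd, lintegral_map (f := fun y => D L (q L y)) (hDm.comp (hq L)) measurable_snd]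
          _ ≤ ∫⁻ y, D L (q L y) ∂β := lintegral_mono' hπ2 le_rfl
          _ = _ := lintegral_comp_label (hq L) _ _
  induction L with
  | zero =>
    intro α β _ _ h
    obtain ⟨α', β', _, _, h1, h0, h2, h3, h4⟩ := match_level 0 α β h
    simp only [Finset.range_zero, Finset.sum_empty, add_zero]
    refine h4 _ ?_
    obtain ⟨π, e1, e2, e3⟩ := exists_coupling_of_le_add (c := c) (f := fun x => E (q 0 x))
      ((measurable_of_countable E).comp (hq 0)) hE α' β' h1
    refine ⟨π, e1, e2, e3.trans ?_⟩
    rw [lintegral_comp_label (hq 0), lintegral_comp_label (hq 0), ← ENNReal.tsum_add]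
    refine ENNReal.tsum_le_tsum fun j => ?_
    rw [← mul_add, h0 j, h2 j, absDiff]
  | succ L ih =>
    intro α β _ _ h
    obtain ⟨α', β', _, _, h1, -, h2, h3, h4⟩ := match_level (L + 1) α β h
    rw [add_assoc]
    refine h4 _ ?_
    obtain ⟨π, e1, e2, e3⟩ := ih α' β' h1
    refine ⟨π, e1, e2, e3.trans ?_⟩
    gcongr ?_ + ?_
    · rw [Finset.sum_range_succ, add_comm]
      gcongr ?_ + ?_
      · refine Finset.sum_le_sum fun l hl => ENNReal.tsum_le_tsum fun j => ?_
        rw [h3 (l + 1) (by simp at hl; omega)]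
      -- The sum over cells of level `L` is regrouped over their children of level `L + 1`, where
      -- the mass of `β'` is only the excess of `β` over `α`.
      · rw [← lintegral_comp_label (hq L)]
        simp_rw [hg L]
        rw [lintegral_comp_label (hq (L + 1)) (fun j => D L (g j))]
        refine ENNReal.tsum_le_tsum fun j => ?_
        rw [h2 j]
        gcongr
        exact le_add_self
    · refine ENNReal.tsum_le_tsum fun j => ?_
      rw [h3 0 (by omega)]

end Partition
end EmpiricalWasserstein

/-! ### Dyadic shells, their cells, and the multiscale transport bound. -/

namespace EmpiricalWasserstein

noncomputable section

/-- The index of the dyadic shell `2 ^ (m - 1) < |x| ≤ 2 ^ m` containing `x ≠ 0`, and `none` at `0`. -/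
def shell {d : ℕ} (x : EuclideanSpace ℝ (Fin d)) : Option ℤ :=
  if ‖x.ofLp‖ = 0 then none else some (Int.clog 2 ‖x.ofLp‖)

/-- The outer radius of a shell. -/
def radius : Option ℤ → ℝ
  | none => 0
  | some m => 2 ^ m

/-- The cell of level `l` containing `x`: its shell, and its position in the dyadic subdivision of
the cube circumscribed to the shell. -/
def label {d : ℕ} (l : ℕ) (x : EuclideanSpace ℝ (Fin d)) : Option ℤ × (Fin d → ℤ) :=
  (shell x, fun i => ⌊2 ^ l * (x i / radius (shell x))⌋)

instance : MeasurableSpace (Option ℤ) := ⊤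

variable {d : ℕ}

theorem radius_nonneg (σ : Option ℤ) : 0 ≤ radius σ := by
  cases σ <;> simp [radius]; positivity

theorem shell_eq_some {x : EuclideanSpace ℝ (Fin d)} {m : ℤ} :
    shell x = some m ↔ (2 : ℝ) ^ (m - 1) < ‖x.ofLp‖ ∧ ‖x.ofLp‖ ≤ 2 ^ m := by
  unfold shell
  rcases (norm_nonneg x.ofLp).eq_or_lt with h | h
  · rw [if_pos h.symm, ← h]
    simp only [reduceCtorEq, false_iff, not_and]
    intro h'
    exact absurd h' (zpow_nonneg (by norm_num) _).not_gt
  · rw [if_neg h.ne', Option.some_inj]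
    have h1 := Int.le_zpow_iff_clog_le (b := 2) one_lt_two (x := m) h
    have h2 := Int.zpow_lt_iff_lt_clog (b := 2) one_lt_two (x := m - 1) h
    push_cast at h1 h2
    rw [h1, h2]
    omega

theorem shell_eq_none {x : EuclideanSpace ℝ (Fin d)} : shell x = none ↔ ‖x.ofLp‖ = 0 := by
  unfold shell
  split_ifs <;> simp_all

theorem norm_le_radius (x : EuclideanSpace ℝ (Fin d)) : ‖x.ofLp‖ ≤ radius (shell x) := by
  rcases h : shell x with _ | m
  · rw [shell_eq_none.1 h]; rfl
  · exact (shell_eq_some.1 h).2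

theorem measurable_supNorm : Measurable fun x : EuclideanSpace ℝ (Fin d) => ‖x.ofLp‖ :=
  ((PiLp.continuous_ofLp 2 _).norm).measurable

theorem measurable_shell : Measurable (shell (d := d)) := by
  refine measurable_to_countable' fun σ => ?_
  rcases σ with _ | m
  · simp only [preimage, mem_singleton_iff, shell_eq_none]
    exact measurableSet_eq_fun measurable_supNorm measurable_const
  · simp only [preimage, mem_singleton_iff, shell_eq_some]
    exact (measurableSet_lt measurable_const measurable_supNorm).inter
      (measurableSet_le measurable_supNorm measurable_const)

theorem measurable_label (l : ℕ) : Measurable (label (d := d) l) := by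
  refine measurable_shell.prodMk (measurable_pi_lambda _ fun i => ?_)
  refine Int.measurable_floor.comp (measurable_const.mul (Measurable.div ?_ ?_))
  · fun_prop
  · exact (measurable_of_countable radius).comp measurable_shell

/-- Nestedness of the partitions: integer division by `2` rounds down, also for negative positions,
so it sends a dyadic cell to its parent. -/
theorem label_eq_label_succ (l : ℕ) (x : EuclideanSpace ℝ (Fin d)) :
    label l x = ((label (l + 1) x).1, fun i => (label (l + 1) x).2 i / 2) := by
  refine Prod.ext rfl (funext fun i => ?_)
  simp only [label]
  set u := x i / radius (shell x)
  have h1 := Int.floor_le (2 ^ (l + 1) * u)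
  have h2 := Int.lt_floor_add_one (2 ^ (l + 1) * u)
  set k := ⌊2 ^ (l + 1) * u⌋
  rw [Int.floor_eq_iff]
  have h3 : ((2 * (k / 2) : ℤ) : ℝ) ≤ k := by exact_mod_cast (by omega)
  have h4 : (k + 1 : ℝ) ≤ ((2 * (k / 2) + 2 : ℤ) : ℝ) := by exact_mod_cast (by omega)
  push_cast at h3 h4
  rw [pow_succ] at h1 h2
  constructor <;> linarith

theorem norm_le_sqrt_mul {z : EuclideanSpace ℝ (Fin d)} {M : ℝ} (hM : 0 ≤ M)
    (h : ∀ i, |z i| ≤ M) : ‖z‖ ≤ √d * M := by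
  rw [EuclideanSpace.norm_eq]
  calc √(∑ i, ‖z i‖ ^ 2) ≤ √(∑ _i : Fin d, M ^ 2) := by
        gcongr with i
        exact h i
    _ = √d * M := by
        simp [Real.sqrt_sq hM]

theorem norm_le_sqrt_mul_radius (x : EuclideanSpace ℝ (Fin d)) : ‖x‖ ≤ √d * radius (shell x) :=
  norm_le_sqrt_mul (radius_nonneg _) fun i => (norm_le_pi_norm x.ofLp i).trans (norm_le_radius x)

theorem norm_sub_le_of_label_eq {l : ℕ} {x y : EuclideanSpace ℝ (Fin d)}
    (h : label l x = label l y) : ‖x - y‖ ≤ √d * (radius (shell y) * (1 / 2) ^ l) := by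
  have hs : shell x = shell y := congrArg Prod.fst h
  refine norm_le_sqrt_mul (mul_nonneg (radius_nonneg _) (by positivity)) fun i => ?_
  rcases (radius_nonneg (shell y)).eq_or_lt with h0 | h0
  -- Radius zero means that both points are the origin; the floors then carry no information.
  · have hx : |x i| ≤ 0 := by
      rw [h0, ← hs]; exact (norm_le_pi_norm x.ofLp i).trans (norm_le_radius x)
    have hy : |y i| ≤ 0 := by
      rw [h0]; exact (norm_le_pi_norm y.ofLp i).trans (norm_le_radius y)
    rw [abs_nonpos_iff] at hx hy
    simp [hx, hy, ← h0]
  · have hk : ⌊2 ^ l * (x i / radius (shell y))⌋ = ⌊2 ^ l * (y i / radius (shell y))⌋ := by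
      have := congrFun (congrArg Prod.snd h) i
      simpa only [label, hs] using this
    have := Int.abs_sub_lt_one_of_floor_eq_floor hk
    have e : 2 ^ l * (x i / radius (shell y)) - 2 ^ l * (y i / radius (shell y)) =
        2 ^ l / radius (shell y) * (x - y) i := by
      simp; field_simp
    rw [e, abs_mul, abs_of_pos (by positivity)] at this
    have h3 : |(x - y) i| = (radius (shell y) * (1 / 2) ^ l) *
        (2 ^ l / radius (shell y) * |(x - y) i|) := by
      field_simp; rw [mul_assoc, ← mul_pow]; norm_num
    rw [h3]
    exact mul_le_of_le_one_right (by positivity) this.le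

/-- The positions of the cells of level `l` in a shell. -/
def grid (d l : ℕ) : Finset (Fin d → ℤ) :=
  Fintype.piFinset fun _ => Finset.Icc (-2 ^ l) (2 ^ l)

/-- Each coordinate has `2 * 2^l + 1 ≤ 4 * 2^l` positions, the last one because a coordinate may
equal the radius. The growth `2^(dl)` is what makes `p = d/2` critical. -/
theorem card_grid_le (d l : ℕ) : (grid d l).card ≤ 4 ^ d * 2 ^ (d * l) := by
  rw [grid, Fintype.card_piFinset]
  simp only [Int.card_Icc, Finset.prod_const, Finset.card_univ, Fintype.card_fin]
  rw [mul_comm d l, pow_mul, ← mul_pow]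
  refine Nat.pow_le_pow_left ?_ d
  have : (1 : ℤ) ≤ 2 ^ l := one_le_pow₀ (by norm_num)
  zify
  rw [Int.toNat_of_nonneg (by linarith)]
  linarith

theorem label_snd_mem_grid (l : ℕ) (x : EuclideanSpace ℝ (Fin d)) : (label l x).2 ∈ grid d l := by
  rw [grid, Fintype.mem_piFinset]
  intro i
  have h : |x i / radius (shell x)| ≤ 1 := by
    rw [abs_div, abs_of_nonneg (radius_nonneg _)]
    exact div_le_one_of_le₀ ((norm_le_pi_norm x.ofLp i).trans (norm_le_radius x))
      (radius_nonneg _)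
  rw [abs_le] at h
  have h2 : (0 : ℝ) < 2 ^ l := by positivity
  simp only [label, Finset.mem_Icc]
  constructor
  · rw [Int.le_floor]; push_cast; nlinarith
  · have : (⌊2 ^ l * (x i / radius (shell x))⌋ : ℝ) ≤ 2 ^ l := by
      refine (Int.floor_le _).trans ?_
      nlinarith
    rw [← Int.cast_le (R := ℝ)]
    push_cast
    exact this

theorem label_preimage_eq_empty {l : ℕ} {σ : Option ℤ} {k : Fin d → ℤ} (hk : k ∉ grid d l) :
    label l ⁻¹' {(σ, k)} = (∅ : Set (EuclideanSpace ℝ (Fin d))) := by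
  ext x
  simp only [mem_preimage, mem_singleton_iff, mem_empty_iff_false, iff_false]
  intro h
  exact hk (by have := label_snd_mem_grid l x; rwa [h] at this)

/-- The total discrepancy of two measures over the cells of level `l` in the shell `σ`. -/
def discrepancy (ν μ : Measure (EuclideanSpace ℝ (Fin d))) (l : ℕ) (σ : Option ℤ) : ℝ≥0∞ :=
  ∑ k ∈ grid d l, absDiff (ν (label l ⁻¹' {(σ, k)})) (μ (label l ⁻¹' {(σ, k)}))

/-- The weight of a shell in the bound for the transport cost. -/
def weight (p : ℝ) (σ : Option ℤ) : ℝ≥0∞ := ENNReal.ofReal (radius σ ^ p)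

/-- The ratio of the costs at consecutive levels. -/
def ratio (p : ℝ) : ℝ≥0∞ := ENNReal.ofReal ((1 / 2) ^ p)

theorem tsum_absDiff_eq (ν μ : Measure (EuclideanSpace ℝ (Fin d))) (l : ℕ)
    (F : Option ℤ → ℝ≥0∞) :
    ∑' j : Option ℤ × (Fin d → ℤ), F j.1 * absDiff (ν (label l ⁻¹' {j})) (μ (label l ⁻¹' {j})) =
      ∑' σ, F σ * discrepancy ν μ l σ := by
  rw [ENNReal.tsum_prod']
  congr 1
  ext σ
  dsimp only
  rw [ENNReal.tsum_mul_left]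
  congr 1
  exact tsum_eq_sum fun k hk => by simp [label_preimage_eq_empty hk, absDiff]

theorem ratio_lt_one {p : ℝ} (hp : 1 ≤ p) : ratio p < 1 := by
  rw [ratio, ← ENNReal.ofReal_one]
  exact (ENNReal.ofReal_lt_ofReal_iff one_pos).2
    (Real.rpow_lt_one (by norm_num) (by norm_num) (by linarith))

theorem two_rpow_mul_ratio (p : ℝ) : ENNReal.ofReal (2 ^ p) * ratio p = 1 := by
  rw [ratio, ← ENNReal.ofReal_mul (by positivity),
    ← Real.mul_rpow (by norm_num) (by norm_num)]
  norm_num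

theorem cost_le_of_label_eq {p : ℝ} (hp : 1 ≤ p) {l : ℕ} {x y : EuclideanSpace ℝ (Fin d)}
    (h : label l x = label l y) :
    ENNReal.ofReal (‖x - y‖ ^ p) ≤
      ENNReal.ofReal ((2 * √d) ^ p) * ratio p ^ l * weight p (shell y) := by
  rw [ratio, weight, ← ENNReal.ofReal_pow (by positivity), ← ENNReal.ofReal_mul (by positivity),
    ← ENNReal.ofReal_mul (by positivity)]
  refine ENNReal.ofReal_le_ofReal ?_
  have hr := radius_nonneg (shell y)
  -- The factor `2` is slack here; it gives the same constant as in `cost_le_weight_add`, where it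
  -- comes from the triangle inequality.
  calc ‖x - y‖ ^ p ≤ ((2 * √d) * (1 / 2) ^ l * radius (shell y)) ^ p := by
        refine Real.rpow_le_rpow (norm_nonneg _) ((norm_sub_le_of_label_eq h).trans ?_)
          (by linarith)
        have : 0 ≤ √d * (radius (shell y) * (1 / 2) ^ l) := by positivity
        nlinarith
    _ = _ := by
        rw [Real.mul_rpow (by positivity) hr, Real.mul_rpow (by positivity) (by positivity),
          ← Real.rpow_natCast, ← Real.rpow_natCast, ← Real.rpow_mul (by norm_num),
          ← Real.rpow_mul (by norm_num), mul_comm p]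

theorem cost_le_weight_add {p : ℝ} (hp : 1 ≤ p) (x y : EuclideanSpace ℝ (Fin d)) :
    ENNReal.ofReal (‖x - y‖ ^ p) ≤
      ENNReal.ofReal ((2 * √d) ^ p) * weight p (shell x) +
        ENNReal.ofReal ((2 * √d) ^ p) * weight p (shell y) := by
  have hx := radius_nonneg (shell x)
  have hy := radius_nonneg (shell y)
  have key : ∀ r, 0 ≤ r → radius (shell x) ≤ r → radius (shell y) ≤ r →
      ENNReal.ofReal (‖x - y‖ ^ p) ≤
        ENNReal.ofReal ((2 * √d) ^ p) * ENNReal.ofReal (r ^ p) := by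
    intro r hr h1 h2
    rw [← ENNReal.ofReal_mul (by positivity), ← Real.mul_rpow (by positivity) hr]
    refine ENNReal.ofReal_le_ofReal (Real.rpow_le_rpow (norm_nonneg _) ?_ (by linarith))
    calc ‖x - y‖ ≤ ‖x‖ + ‖y‖ := norm_sub_le _ _
      _ ≤ √d * radius (shell x) + √d * radius (shell y) :=
        add_le_add (norm_le_sqrt_mul_radius x) (norm_le_sqrt_mul_radius y)
      _ ≤ √d * r + √d * r := by gcongr
      _ = 2 * √d * r := by ring
  rcases le_total (radius (shell x)) (radius (shell y)) with h | h
  · exact (key _ hy h le_rfl).trans le_add_self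
  · exact (key _ hx le_rfl h).trans le_self_add

/-- The multiscale bound for the transport cost. -/
theorem wassersteinPow_le {p : ℝ} (hp : 1 ≤ p) (ν μ : Measure (EuclideanSpace ℝ (Fin d)))
    [IsProbabilityMeasure ν] [IsProbabilityMeasure μ]
    (hμ : ∑' σ, weight p σ * μ (shell ⁻¹' {σ}) ≠ ∞) :
    wassersteinPow p ν μ ≤ ENNReal.ofReal ((2 * √d) ^ p) * ENNReal.ofReal (2 ^ p) *
      ∑' l, ratio p ^ l * ∑' σ, weight p σ * discrepancy ν μ l σ := by
  set A := ENNReal.ofReal ((2 * √d) ^ p) with hA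
  set T := ∑' σ, weight p σ * μ (shell ⁻¹' {σ}) with hT
  set S : ℕ → ℝ≥0∞ := fun l => ∑' σ, weight p σ * discrepancy ν μ l σ with hS
  have hB : (1 : ℝ≥0∞) ≤ ENNReal.ofReal (2 ^ p) := by
    rw [← ENNReal.ofReal_one]
    exact ENNReal.ofReal_le_ofReal (Real.one_le_rpow (by norm_num) (by linarith))
  -- Stopping at level `L` leaves the cost of moving inside the finest cells, which tends to `0` as
  -- `L → ∞` because `T` is finite.
  have bound : ∀ L : ℕ, wassersteinPow p ν μ ≤ A * T * ratio p ^ L +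
      A * ENNReal.ofReal (2 ^ p) * ∑' l, ratio p ^ l * S l := by
    intro L
    obtain ⟨π, h1, h2, h3⟩ := exists_coupling_of_nested
      (c := fun z : EuclideanSpace ℝ (Fin d) × EuclideanSpace ℝ (Fin d) =>
        ENNReal.ofReal (‖z.1 - z.2‖ ^ p))
      (q := label) measurable_label (g := fun j => (j.1, fun i => j.2 i / 2))
      label_eq_label_succ (D := fun l j => A * ratio p ^ l * weight p j.1)
      (fun l x y h => cost_le_of_label_eq hp h) (E := fun j => A * weight p j.1)
      (cost_le_weight_add hp) L ν μ (by simp)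
    have hπ : π ∈ couplings ν μ := by
      refine ⟨⟨?_⟩, h1, h2⟩
      rw [← Measure.fst_univ, h1, measure_univ]
    refine (iInf₂_le π hπ).trans (h3.trans ?_)
    rw [add_assoc]
    refine add_le_add (le_of_eq ?_) ?_
    · rw [← lintegral_comp_label (measurable_label L) (fun j => A * ratio p ^ L * weight p j.1)]
      change ∫⁻ x, A * ratio p ^ L * weight p (shell x) ∂μ = _
      rw [lintegral_const_mul (f := fun x => weight p (shell x)) _ ((measurable_of_countable (weight p)).comp measurable_shell),
        lintegral_comp_label measurable_shell, mul_right_comm]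
    · have e0 : ∑' j : Option ℤ × (Fin d → ℤ), A * weight p j.1 *
          absDiff (ν (label 0 ⁻¹' {j})) (μ (label 0 ⁻¹' {j})) = A * S 0 := by
        simp_rw [mul_assoc]
        rw [ENNReal.tsum_mul_left, tsum_absDiff_eq]
      -- The discrepancy of level `l + 1` is paid at the cell size of level `l`; this shift by one
      -- level costs the factor `2 ^ p`.
      have e1 : ∀ l, ∑' j : Option ℤ × (Fin d → ℤ), A * ratio p ^ l * weight p j.1 *
          absDiff (ν (label (l + 1) ⁻¹' {j})) (μ (label (l + 1) ⁻¹' {j})) =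
          A * ENNReal.ofReal (2 ^ p) * (ratio p ^ (l + 1) * S (l + 1)) := by
        intro l
        simp_rw [mul_assoc]
        rw [ENNReal.tsum_mul_left, ENNReal.tsum_mul_left, tsum_absDiff_eq, pow_succ']
        congr 1
        rw [← mul_assoc, ← mul_assoc, two_rpow_mul_ratio, one_mul]
      rw [e0, Finset.sum_congr rfl fun l _ => e1 l, ← Finset.mul_sum]
      calc A * ENNReal.ofReal (2 ^ p) *
            ∑ l ∈ Finset.range L, ratio p ^ (l + 1) * S (l + 1) + A * S 0
          ≤ A * ENNReal.ofReal (2 ^ p) *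
            ∑ l ∈ Finset.range L, ratio p ^ (l + 1) * S (l + 1) +
            A * ENNReal.ofReal (2 ^ p) * (ratio p ^ 0 * S 0) := by
              gcongr
              · exact le_mul_of_one_le_right' hB
              · simp
        _ = A * ENNReal.ofReal (2 ^ p) * ∑ l ∈ Finset.range (L + 1), ratio p ^ l * S l := by
              rw [Finset.sum_range_succ', mul_add]
        _ ≤ _ := by
              gcongr
              exact ENNReal.sum_le_tsum _
  have lim : Filter.Tendsto (fun L : ℕ => A * T * ratio p ^ L +
      A * ENNReal.ofReal (2 ^ p) * ∑' l, ratio p ^ l * S l) Filter.atTop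
      (nhds (A * T * 0 + A * ENNReal.ofReal (2 ^ p) * ∑' l, ratio p ^ l * S l)) := by
    refine Filter.Tendsto.add_const _ (ENNReal.Tendsto.const_mul
      (ENNReal.tendsto_pow_atTop_nhds_zero_of_lt_one (ratio_lt_one hp)) (Or.inr ?_))
    exact ENNReal.mul_ne_top (by simp [hA]) hμ
  rw [mul_zero, zero_add] at lim
  exact ge_of_tendsto' lim bound

end
end EmpiricalWasserstein

/-! ### Minkowski's inequality and second moments of the discrepancies. -/

namespace EmpiricalWasserstein

section Minkowski

variable {Ω ι : Type*} [MeasurableSpace Ω] {P : Measure Ω}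

theorem lintegral_mul_le_sqrt_mul_sqrt {f g : Ω → ℝ≥0∞} (hf : AEMeasurable f P)
    (hg : AEMeasurable g P) :
    ∫⁻ ω, f ω * g ω ∂P ≤
      (∫⁻ ω, f ω ^ 2 ∂P) ^ (1 / 2 : ℝ) * (∫⁻ ω, g ω ^ 2 ∂P) ^ (1 / 2 : ℝ) := by
  simpa [ENNReal.rpow_ofNat] using
    ENNReal.lintegral_mul_le_Lp_mul_Lq P Real.HolderConjugate.two_two hf hg

/-- Minkowski's inequality in `L²` for countable sums of nonnegative functions. -/
theorem lintegral_tsum_sq_le [Countable ι] {f : ι → Ω → ℝ≥0∞} (hf : ∀ i, AEMeasurable (f i) P) :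
    ∫⁻ ω, (∑' i, f i ω) ^ 2 ∂P ≤ (∑' i, (∫⁻ ω, f i ω ^ 2 ∂P) ^ (1 / 2 : ℝ)) ^ 2 := by
  -- Both squares are expanded into double sums and compared term by term with Cauchy–Schwarz.
  have e : ∀ a : ι → ℝ≥0∞, (∑' i, a i) ^ 2 = ∑' i, ∑' j, a i * a j := by
    intro a
    rw [sq, ← ENNReal.tsum_mul_right]
    simp_rw [ENNReal.tsum_mul_left]
  have hm : ∀ i j, AEMeasurable (fun ω => f i ω * f j ω) P := fun i j => (hf i).mul (hf j)
  simp_rw [e]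
  rw [lintegral_tsum fun i => AEMeasurable.tsum fun j => hm i j]
  refine ENNReal.tsum_le_tsum fun i => ?_
  rw [lintegral_tsum fun j => hm i j]
  exact ENNReal.tsum_le_tsum fun j => lintegral_mul_le_sqrt_mul_sqrt (hf i) (hf j)

end Minkowski

theorem absDiff_le_add (a b : ℝ≥0∞) : absDiff a b ≤ a + b :=
  add_le_add tsub_le_self tsub_le_self

theorem absDiff_ofReal {a b : ℝ} (ha : 0 ≤ a) (hb : 0 ≤ b) :
    absDiff (ENNReal.ofReal a) (ENNReal.ofReal b) = ‖a - b‖ₑ := by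
  rw [absDiff, ← ENNReal.ofReal_sub _ hb, ← ENNReal.ofReal_sub _ ha, Real.enorm_eq_ofReal_abs]
  rcases le_total a b with h | h
  · rw [ENNReal.ofReal_of_nonpos (by linarith : a - b ≤ 0), zero_add, abs_sub_comm,
      abs_of_nonneg (by linarith)]
  · rw [ENNReal.ofReal_of_nonpos (by linarith : b - a ≤ 0), add_zero,
      abs_of_nonneg (by linarith)]

theorem aemeasurable_absDiff {Ω : Type*} [MeasurableSpace Ω] {P : Measure Ω} {f : Ω → ℝ≥0∞}
    (hf : AEMeasurable f P) (b : ℝ≥0∞) : AEMeasurable (fun ω => absDiff (f ω) b) P :=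
  (hf.sub aemeasurable_const).add (aemeasurable_const.sub hf)

section Empirical

variable {d n : ℕ}

theorem empiricalMeasure_apply (x : Fin n → EuclideanSpace ℝ (Fin d))
    {Q : Set (EuclideanSpace ℝ (Fin d))} (hQ : MeasurableSet Q) :
    empiricalMeasure x Q = (n : ℝ≥0∞)⁻¹ * ∑ k, Q.indicator 1 (x k) := by
  simp [empiricalMeasure, Measure.dirac_apply' _ hQ]

theorem isProbabilityMeasure_empiricalMeasure (hn : 1 ≤ n)
    (x : Fin n → EuclideanSpace ℝ (Fin d)) : IsProbabilityMeasure (empiricalMeasure x) := by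
  constructor
  rw [empiricalMeasure_apply x MeasurableSet.univ]
  simp only [indicator_univ, Pi.one_apply, Finset.sum_const, Finset.card_univ, Fintype.card_fin,
    nsmul_eq_mul, mul_one]
  exact ENNReal.inv_mul_cancel (by simp; omega) (by simp)

theorem empiricalMeasure_eq_ofReal (hn : 1 ≤ n) (x : Fin n → EuclideanSpace ℝ (Fin d))
    {Q : Set (EuclideanSpace ℝ (Fin d))} (hQ : MeasurableSet Q) :
    empiricalMeasure x Q =
      ENNReal.ofReal ((n : ℝ)⁻¹ * ∑ k, Q.indicator (1 : EuclideanSpace ℝ (Fin d) → ℝ) (x k)) := by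
  have h0 : ∀ y, 0 ≤ Q.indicator (1 : EuclideanSpace ℝ (Fin d) → ℝ) y :=
    fun y => indicator_nonneg (fun _ _ => zero_le_one) y
  have hn0 : (0 : ℝ) < n := by exact_mod_cast hn
  rw [empiricalMeasure_apply x hQ, ENNReal.ofReal_mul (by positivity),
    ENNReal.ofReal_sum_of_nonneg fun k _ => h0 _, ENNReal.ofReal_inv_of_pos hn0,
    ENNReal.ofReal_natCast]
  congr 2
  ext k
  by_cases hk : x k ∈ Q <;> simp [hk]

variable {Ω : Type*} [MeasurableSpace Ω] {P : Measure Ω} {μ : Measure (EuclideanSpace ℝ (Fin d))}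
  {X : Fin n → Ω → EuclideanSpace ℝ (Fin d)}

theorem aemeasurable_empiricalMeasure_apply (hL : ∀ k, HasLaw (X k) μ P)
    {Q : Set (EuclideanSpace ℝ (Fin d))} (hQ : MeasurableSet Q) :
    AEMeasurable (fun ω => empiricalMeasure (fun k => X k ω) Q) P := by
  simp_rw [fun ω => empiricalMeasure_apply (fun k => X k ω) hQ]
  refine AEMeasurable.const_mul (Finset.aemeasurable_fun_sum _ fun k _ => ?_) _
  exact ((measurable_one.indicator hQ).comp_aemeasurable (hL k).aemeasurable)

theorem lintegral_empiricalMeasure_apply (hn : 1 ≤ n) (hL : ∀ k, HasLaw (X k) μ P)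
    {Q : Set (EuclideanSpace ℝ (Fin d))} (hQ : MeasurableSet Q) :
    ∫⁻ ω, empiricalMeasure (fun k => X k ω) Q ∂P = μ Q := by
  simp_rw [fun ω => empiricalMeasure_apply (fun k => X k ω) hQ]
  have hm : ∀ k, AEMeasurable (fun ω => Q.indicator (1 : EuclideanSpace ℝ (Fin d) → ℝ≥0∞) (X k ω)) P :=
    fun k => (measurable_one.indicator hQ).comp_aemeasurable (hL k).aemeasurable
  have hk : ∀ k, ∫⁻ ω, Q.indicator (1 : EuclideanSpace ℝ (Fin d) → ℝ≥0∞) (X k ω) ∂P = μ Q := by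
    intro k
    rw [← lintegral_indicator_one hQ, ← (hL k).map_eq,
      lintegral_map' (measurable_one.indicator hQ).aemeasurable (hL k).aemeasurable]
  rw [lintegral_const_mul'' _ (Finset.aemeasurable_fun_sum _ fun k _ => hm k),
    lintegral_finsetSum' _ fun k _ => hm k]
  simp only [hk, Finset.sum_const, Finset.card_univ, Fintype.card_fin, nsmul_eq_mul]
  rw [← mul_assoc, ENNReal.inv_mul_cancel (by simp; omega) (by simp), one_mul]

variable [IsProbabilityMeasure P] [IsProbabilityMeasure μ]

/-- `μ_n(Q)` is the mean of `n` independent indicators with expectation `μ(Q)`, each of variance at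
most `μ(Q)`. -/
theorem lintegral_absDiff_sq_le (hn : 1 ≤ n) (hX : iIndepFun X P) (hL : ∀ k, HasLaw (X k) μ P)
    {Q : Set (EuclideanSpace ℝ (Fin d))} (hQ : MeasurableSet Q) :
    ∫⁻ ω, absDiff (empiricalMeasure (fun k => X k ω) Q) (μ Q) ^ 2 ∂P ≤ (n : ℝ≥0∞)⁻¹ * μ Q := by
  have hn0 : (0 : ℝ) < n := by exact_mod_cast hn
  set φ : EuclideanSpace ℝ (Fin d) → ℝ := Q.indicator 1 with hφ
  have hφm : Measurable φ := measurable_one.indicator hQ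
  have hφ0 : ∀ y, 0 ≤ φ y := fun y => indicator_nonneg (fun _ _ => zero_le_one) y
  have hφ1 : ∀ y, ‖φ y‖ ≤ 1 := fun y => by
    by_cases hy : y ∈ Q <;> simp [hφ, hy]
  have hφsq : ∀ y, φ y ^ 2 = φ y := fun y => by
    by_cases hy : y ∈ Q <;> simp [hφ, hy]
  have hYm : ∀ k, AEMeasurable (φ ∘ X k) P := fun k => hφm.comp_aemeasurable (hL k).aemeasurable
  have hmem : ∀ k, MemLp (φ ∘ X k) 2 P := fun k =>
    MemLp.of_bound (hYm k).aestronglyMeasurable 1 (ae_of_all _ fun ω => hφ1 _)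
  have hE : ∀ k, ∫ ω, φ (X k ω) ∂P = μ.real Q := by
    intro k
    rw [← integral_indicator_one hQ, ← (hL k).map_eq,
      integral_map (hL k).aemeasurable hφm.aestronglyMeasurable]
  have hV : ∀ k, Var[φ ∘ X k; P] ≤ μ.real Q := by
    intro k
    refine (variance_le_expectation_sq (hYm k).aestronglyMeasurable).trans_eq ?_
    rw [← hE k]
    refine integral_congr_ae (ae_of_all _ fun ω => ?_)
    simp [hφsq]
  set Z : Ω → ℝ := fun ω => (n : ℝ)⁻¹ * (∑ k, φ ∘ X k) ω with hZ
  have hsum : MemLp (∑ k, φ ∘ X k) 2 P := memLp_finsetSum' _ fun k _ => hmem k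
  have hZm : MemLp Z 2 P := hsum.const_mul _
  have hEZ : ∫ ω, Z ω ∂P = μ.real Q := by
    simp only [hZ, Finset.sum_apply, Function.comp_apply]
    rw [integral_const_mul, integral_finsetSum _ fun k _ =>
      show Integrable (fun ω => φ (X k ω)) P from (hmem k).integrable one_le_two]
    simp only [hE, Finset.sum_const, Finset.card_univ, Fintype.card_fin, nsmul_eq_mul]
    field_simp
  have hVZ : Var[Z; P] ≤ (n : ℝ)⁻¹ * μ.real Q := by
    rw [hZ, variance_const_mul, IndepFun.variance_sum (fun k _ => hmem k)
      fun i _ j _ hij => (hX.comp (fun _ => φ) fun _ => hφm).indepFun hij]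
    calc (n : ℝ)⁻¹ ^ 2 * ∑ k, Var[φ ∘ X k; P] ≤ (n : ℝ)⁻¹ ^ 2 * ∑ _k : Fin n, μ.real Q := by
          gcongr with k; exact hV k
      _ = _ := by simp; field_simp
  have hpt : ∀ ω, absDiff (empiricalMeasure (fun k => X k ω) Q) (μ Q) = ‖Z ω - P[Z]‖ₑ := by
    intro ω
    rw [empiricalMeasure_eq_ofReal hn _ hQ, ← ofReal_measureReal (μ := μ), absDiff_ofReal
      (mul_nonneg (by positivity) (Finset.sum_nonneg fun k _ => hφ0 _)) measureReal_nonneg, hEZ]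
    simp [hZ, hφ]
  simp_rw [hpt]
  change evariance Z P ≤ _
  rw [← hZm.ofReal_variance_eq]
  refine (ENNReal.ofReal_le_ofReal hVZ).trans_eq ?_
  rw [ENNReal.ofReal_mul (by positivity), ENNReal.ofReal_inv_of_pos hn0, ENNReal.ofReal_natCast,
    ofReal_measureReal]

omit [IsProbabilityMeasure P] [IsProbabilityMeasure μ] in
theorem aemeasurable_discrepancy (hL : ∀ k, HasLaw (X k) μ P) (l : ℕ) (σ : Option ℤ) :
    AEMeasurable (fun ω => discrepancy (empiricalMeasure fun k => X k ω) μ l σ) P :=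
  Finset.aemeasurable_fun_sum _ fun _ _ => aemeasurable_absDiff
    (aemeasurable_empiricalMeasure_apply hL (measurable_label l (measurableSet_singleton _))) _

theorem sum_grid_measure_le (ν : Measure (EuclideanSpace ℝ (Fin d))) (l : ℕ) (σ : Option ℤ) :
    ∑ k ∈ grid d l, ν (label l ⁻¹' {(σ, k)}) ≤ ν (shell ⁻¹' {σ}) := by
  have h := sum_measure_preimage_singleton (μ := ν)
    ((grid d l).map ⟨fun k => (σ, k), Prod.mk_right_injective σ⟩)
    (f := label l) fun y _ => measurable_label l (measurableSet_singleton y)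
  rw [Finset.sum_map] at h
  refine h.trans_le (measure_mono fun x hx => ?_)
  simp only [Finset.coe_map, Function.Embedding.coeFn_mk, mem_preimage, mem_image] at hx
  obtain ⟨k, -, hk⟩ := hx
  exact (congrArg Prod.fst hk).symm

/-- The second moment of the discrepancy in a shell. -/
theorem lintegral_discrepancy_sq_le (hn : 1 ≤ n) (hX : iIndepFun X P)
    (hL : ∀ k, HasLaw (X k) μ P) (l : ℕ) (σ : Option ℤ) :
    ∫⁻ ω, discrepancy (empiricalMeasure fun k => X k ω) μ l σ ^ 2 ∂P ≤
      4 * μ (shell ⁻¹' {σ}) * min 1 ((grid d l).card * (n : ℝ≥0∞)⁻¹) := by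
  have hcell : ∀ k, MeasurableSet (label l ⁻¹' {(σ, k)} : Set (EuclideanSpace ℝ (Fin d))) :=
    fun k => measurable_label l (measurableSet_singleton _)
  have hs : MeasurableSet (shell ⁻¹' {σ} : Set (EuclideanSpace ℝ (Fin d))) :=
    measurable_shell (measurableSet_singleton _)
  rw [mul_min]
  refine le_min ?_ ?_
  -- Trivial bound: one factor of the square is at most `2`, the other at most the sum of the two
  -- shell masses, whose expectation is `2 μ(shell)`.
  · calc ∫⁻ ω, discrepancy (empiricalMeasure fun k => X k ω) μ l σ ^ 2 ∂P
        ≤ ∫⁻ ω, 2 * (empiricalMeasure (fun k => X k ω) (shell ⁻¹' {σ}) +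
            μ (shell ⁻¹' {σ})) ∂P := by
          refine lintegral_mono fun ω => ?_
          have := isProbabilityMeasure_empiricalMeasure hn fun k => X k ω
          have h1 : discrepancy (empiricalMeasure fun k => X k ω) μ l σ ≤
              empiricalMeasure (fun k => X k ω) (shell ⁻¹' {σ}) + μ (shell ⁻¹' {σ}) := by
            refine (Finset.sum_le_sum fun k _ => absDiff_le_add _ _).trans ?_
            rw [Finset.sum_add_distrib]
            exact add_le_add (sum_grid_measure_le _ l σ) (sum_grid_measure_le _ l σ)
          have h2 : discrepancy (empiricalMeasure fun k => X k ω) μ l σ ≤ 2 := by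
            refine h1.trans ((add_le_add prob_le_one prob_le_one).trans_eq one_add_one_eq_two)
          dsimp only
          rw [sq]
          exact mul_le_mul' h2 h1
      _ = 4 * μ (shell ⁻¹' {σ}) * 1 := by
          rw [lintegral_const_mul' _ _ ENNReal.ofNat_ne_top, lintegral_add_right _ measurable_const,
            lintegral_empiricalMeasure_apply hn hL hs]
          simp only [lintegral_const, measure_univ, mul_one]
          ring
  -- Statistical bound: Cauchy–Schwarz over the cells, then the variance bound in each cell.
  · calc ∫⁻ ω, discrepancy (empiricalMeasure fun k => X k ω) μ l σ ^ 2 ∂P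
        ≤ ∫⁻ ω, (grid d l).card * ∑ k ∈ grid d l, absDiff
            (empiricalMeasure (fun k => X k ω) (label l ⁻¹' {(σ, k)}))
            (μ (label l ⁻¹' {(σ, k)})) ^ 2 ∂P := by
          refine lintegral_mono fun ω => ?_
          have := ENNReal.rpow_sum_le_const_mul_sum_rpow (grid d l) (fun k => absDiff
            (empiricalMeasure (fun k => X k ω) (label l ⁻¹' {(σ, k)}))
            (μ (label l ⁻¹' {(σ, k)}))) one_le_two
          norm_num [ENNReal.rpow_ofNat] at this
          exact this
      _ = (grid d l).card * ∑ k ∈ grid d l, ∫⁻ ω, absDiff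
            (empiricalMeasure (fun k => X k ω) (label l ⁻¹' {(σ, k)}))
            (μ (label l ⁻¹' {(σ, k)})) ^ 2 ∂P := by
          have hm : ∀ k, AEMeasurable (fun ω => absDiff
              (empiricalMeasure (fun k => X k ω) (label l ⁻¹' {(σ, k)}))
              (μ (label l ⁻¹' {(σ, k)})) ^ 2) P := fun k =>
            (aemeasurable_absDiff (aemeasurable_empiricalMeasure_apply hL (hcell k)) _).pow_const 2
          rw [lintegral_const_mul'' _ (Finset.aemeasurable_fun_sum _ fun k _ => hm k),
            lintegral_finsetSum' _ fun k _ => hm k]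
      _ ≤ (grid d l).card * ∑ k ∈ grid d l, (n : ℝ≥0∞)⁻¹ * μ (label l ⁻¹' {(σ, k)}) := by
          gcongr with k
          exact lintegral_absDiff_sq_le hn hX hL (hcell k)
      _ ≤ (grid d l).card * ((n : ℝ≥0∞)⁻¹ * μ (shell ⁻¹' {σ})) := by
          rw [← Finset.mul_sum]
          gcongr
          exact sum_grid_measure_le _ l σ
      _ = 1 * μ (shell ⁻¹' {σ}) * ((grid d l).card * (n : ℝ≥0∞)⁻¹) := by ring
      _ ≤ _ := by gcongr; norm_num

end Empirical

end EmpiricalWasserstein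

/-! ### Measurability of the empirical transport cost. -/

namespace EmpiricalWasserstein

variable {d n : ℕ}

/-- Where the integral is infinite nothing is required. Where it is finite, dominated convergence
gives continuity at `x`, with domination from `(a + 1)^p ≤ 2^(p-1) (a^p + 1)`. -/
theorem upperSemicontinuous_lintegral_cost {p : ℝ} (hp : 1 ≤ p)
    (ν : Measure (EuclideanSpace ℝ (Fin d))) [IsFiniteMeasure ν] :
    UpperSemicontinuous fun x => ∫⁻ y, ENNReal.ofReal (‖x - y‖ ^ p) ∂ν := by
  intro x a hx
  have hfin : ∫⁻ y, ENNReal.ofReal (‖x - y‖ ^ p) ∂ν ≠ ∞ := (lt_top_of_lt hx).ne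
  have hm : ∀ x : EuclideanSpace ℝ (Fin d),
      Measurable fun y => ENNReal.ofReal (‖x - y‖ ^ p) := fun x =>
    ENNReal.measurable_ofReal.comp
      ((Real.continuous_rpow_const (by linarith)).comp (by fun_prop)).measurable
  have h := tendsto_lintegral_filter_of_dominated_convergence (μ := ν) (l := nhds x)
    (F := fun x' y => ENNReal.ofReal (‖x' - y‖ ^ p)) (f := fun y => ENNReal.ofReal (‖x - y‖ ^ p))
    (fun y => 2 ^ (p - 1) * (ENNReal.ofReal (‖x - y‖ ^ p) + 1))
    (Filter.Eventually.of_forall hm) ?_ ?_ ?_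
  · exact h.eventually_lt_const hx
  · filter_upwards [Metric.ball_mem_nhds x one_pos] with x' hx'
    refine ae_of_all _ fun y => ?_
    rw [mem_ball_iff_norm] at hx'
    have h1 : ‖x' - y‖ ≤ ‖x - y‖ + 1 := by
      calc ‖x' - y‖ = ‖(x - y) + (x' - x)‖ := by congr 1; abel
        _ ≤ ‖x - y‖ + ‖x' - x‖ := norm_add_le _ _
        _ ≤ _ := by gcongr
    rw [← ENNReal.ofReal_rpow_of_nonneg (norm_nonneg _) (by linarith),
      ← ENNReal.ofReal_rpow_of_nonneg (norm_nonneg _) (by linarith)]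
    have h2 := ENNReal.rpow_add_le_mul_rpow_add_rpow (ENNReal.ofReal ‖x - y‖) 1 hp
    rw [ENNReal.one_rpow] at h2
    refine le_trans ?_ h2
    refine ENNReal.rpow_le_rpow ?_ (by linarith)
    rw [← ENNReal.ofReal_one, ← ENNReal.ofReal_add (norm_nonneg _) zero_le_one]
    exact ENNReal.ofReal_le_ofReal h1
  · have h2 : (2 : ℝ≥0∞) ^ (p - 1) ≠ ∞ :=
      ENNReal.rpow_ne_top_of_nonneg (by linarith) ENNReal.ofNat_ne_top
    rw [lintegral_const_mul' _ _ h2,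
      lintegral_add_right _ measurable_const]
    refine ENNReal.mul_ne_top h2 (ENNReal.add_ne_top.2 ⟨hfin, ?_⟩)
    simp
  · refine ae_of_all _ fun y => ?_
    refine (ENNReal.continuous_ofReal.tendsto _).comp ?_
    exact (((Real.continuous_rpow_const (by linarith)).comp
      ((continuous_id.sub continuous_const).norm)).tendsto x)

theorem lintegral_empiricalMeasure (x : Fin n → EuclideanSpace ℝ (Fin d))
    {f : EuclideanSpace ℝ (Fin d) → ℝ≥0∞} (hf : Measurable f) :
    ∫⁻ y, f y ∂(empiricalMeasure x) = (n : ℝ≥0∞)⁻¹ * ∑ k, f (x k) := by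
  rw [empiricalMeasure, lintegral_smul_measure, lintegral_finsetSum_measure]
  simp [lintegral_dirac' _ hf]

/-- A coupling of an empirical measure with `μ` amounts to writing `μ` as the average of the images
of the atoms. -/
theorem wassersteinPow_empiricalMeasure {p : ℝ} (hp : 1 ≤ p) (hn : 1 ≤ n)
    (μ : Measure (EuclideanSpace ℝ (Fin d))) (x : Fin n → EuclideanSpace ℝ (Fin d)) :
    wassersteinPow p (empiricalMeasure x) μ =
      ⨅ ν : {ν : Fin n → ProbabilityMeasure (EuclideanSpace ℝ (Fin d)) //
          (n : ℝ≥0∞)⁻¹ • ∑ k, (ν k : Measure (EuclideanSpace ℝ (Fin d))) = μ},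
        ∑ k, (n : ℝ≥0∞)⁻¹ * ∫⁻ y, ENNReal.ofReal (‖x k - y‖ ^ p) ∂(ν.1 k : Measure _) := by
  have hprob := isProbabilityMeasure_empiricalMeasure hn x
  have hc : Measurable fun z : EuclideanSpace ℝ (Fin d) × EuclideanSpace ℝ (Fin d) =>
      ENNReal.ofReal (‖z.1 - z.2‖ ^ p) :=
    ENNReal.measurable_ofReal.comp
      ((Real.continuous_rpow_const (by linarith)).comp (by fun_prop)).measurable
  refine le_antisymm ?_ ?_
  · refine le_iInf fun ν => ?_
    obtain ⟨ν, hν⟩ := ν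
    set π : Measure (EuclideanSpace ℝ (Fin d) × EuclideanSpace ℝ (Fin d)) :=
      (n : ℝ≥0∞)⁻¹ • ∑ k, (Measure.dirac (x k)).prod (ν k : Measure _) with hπ
    have h1 : π.fst = empiricalMeasure x := by
      ext s hs
      rw [Measure.fst_apply hs, empiricalMeasure_apply x hs, hπ, Measure.smul_apply,
        Measure.finsetSum_apply, smul_eq_mul]
      congr 2
      ext k
      rw [← prod_univ, Measure.prod_prod, measure_univ, mul_one, Measure.dirac_apply' _ hs]
    have h2 : π.snd = μ := by
      rw [← hν]
      ext s hs
      rw [Measure.snd_apply hs, hπ, Measure.smul_apply, Measure.smul_apply,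
        Measure.finsetSum_apply, Measure.finsetSum_apply]
      congr 2
      ext k
      rw [← univ_prod, Measure.prod_prod, measure_univ, one_mul]
    have hmem : π ∈ couplings (empiricalMeasure x) μ := by
      refine ⟨⟨?_⟩, h1, h2⟩
      rw [← Measure.fst_univ, h1, measure_univ]
    refine (iInf₂_le π hmem).trans (le_of_eq ?_)
    rw [hπ, lintegral_smul_measure, lintegral_finsetSum_measure, smul_eq_mul, Finset.mul_sum]
    congr 1
    ext k
    rw [Measure.dirac_prod, lintegral_map hc measurable_prodMk_left]
  · refine le_iInf₂ fun π hπ => ?_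
    obtain ⟨_, h1, h2⟩ := hπ
    -- The decomposition of `μ` is read off by disintegrating `π` over its first margin: the atom `x
    -- k` is sent to `κ (x k)`. Coinciding atoms receive the same image.
    set κ := π.condKernel
    have hdis : π.fst.compProd κ = π := π.disintegrate κ
    have hsnd : (n : ℝ≥0∞)⁻¹ • ∑ k, κ (x k) = μ := by
      rw [← h2]
      ext s hs
      conv_rhs => rw [← hdis, Measure.snd_compProd, h1, Measure.bind_apply hs κ.aemeasurable,
        lintegral_empiricalMeasure x (κ.measurable_coe hs)]
      rw [Measure.smul_apply, Measure.finsetSum_apply, smul_eq_mul]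
    refine (iInf_le _ ⟨fun k => ⟨κ (x k), inferInstance⟩, hsnd⟩).trans (le_of_eq ?_)
    conv_rhs => rw [← hdis, Measure.lintegral_compProd hc, h1,
      lintegral_empiricalMeasure x hc.lintegral_kernel_prod_right', Finset.mul_sum]
    rfl

/-- The infimum is uncountable, but its index set, the decompositions of `μ`, does not depend on the
sample. An infimum of upper semicontinuous functions is upper semicontinuous, hence Borel. -/
theorem measurable_wassersteinPow_empiricalMeasure {p : ℝ} (hp : 1 ≤ p) (hn : 1 ≤ n)
    (μ : Measure (EuclideanSpace ℝ (Fin d))) :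
    Measurable fun x : Fin n → EuclideanSpace ℝ (Fin d) =>
      wassersteinPow p (empiricalMeasure x) μ := by
  simp_rw [wassersteinPow_empiricalMeasure hp hn μ]
  refine (upperSemicontinuous_iInf fun ν => upperSemicontinuous_sum fun k _ => ?_).measurable
  have hn0 : (n : ℝ≥0∞)⁻¹ ≠ ∞ := by simp; omega
  refine (ENNReal.continuous_const_mul hn0).comp_upperSemicontinuous ?_
    (fun a b hab => mul_le_mul_right hab _)
  exact (upperSemicontinuous_lintegral_cost hp _).comp (continuous_apply k)

theorem aemeasurable_empiricalWassersteinPow {Ω : Type*} [MeasurableSpace Ω] {P : Measure Ω}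
    {μ : Measure (EuclideanSpace ℝ (Fin d))} {X : Fin n → Ω → EuclideanSpace ℝ (Fin d)}
    {p : ℝ} (hp : 1 ≤ p) (hn : 1 ≤ n) (hL : ∀ k, HasLaw (X k) μ P) :
    AEMeasurable (empiricalWassersteinPow p X μ) P :=
  (measurable_wassersteinPow_empiricalMeasure hp hn μ).comp_aemeasurable
    (aemeasurable_pi_lambda _ fun k => (hL k).aemeasurable)

end EmpiricalWasserstein

/-! ### From the sum over shells to the tail integral, and the `L²` bound. -/

namespace EmpiricalWasserstein

section Tail

variable {d : ℕ}

theorem tail_anti (μ : Measure (EuclideanSpace ℝ (Fin d))) [IsFiniteMeasure μ] :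
    Antitone (tail μ) := fun _ _ h =>
  measureReal_mono fun _ hx => lt_of_le_of_lt h hx

/-- The shell has mass at most `H(2r)` with `r = 2^(m-2)`. On `(r, 2r]`, an interval of length `r`,
the integrand is at least `r^(p-1) √H(2r)`, and `(4r)^p = 4^p * r^(p-1) * r`. These intervals are
disjoint for distinct `m`. -/
theorem weight_mul_sqrt_le {p : ℝ} (hp : 1 ≤ p) (μ : Measure (EuclideanSpace ℝ (Fin d)))
    [IsFiniteMeasure μ] (m : ℤ) :
    weight p (some m) * μ (shell ⁻¹' {some m}) ^ (1 / 2 : ℝ) ≤ ENNReal.ofReal (4 ^ p) *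
      ∫⁻ t in Ioc ((2 : ℝ) ^ (m - 2)) (2 ^ (m - 1)), ENNReal.ofReal (t ^ (p - 1) * √(tail μ t)) := by
  set r : ℝ := 2 ^ (m - 2) with hr
  have hr0 : 0 < r := by positivity
  have h1 : (2 : ℝ) ^ (m - 1) = 2 * r := by
    rw [hr, show m - 1 = (m - 2) + 1 by ring, zpow_add_one₀ (by norm_num)]; ring
  have h2 : (2 : ℝ) ^ m = 4 * r := by
    rw [show m = (m - 1) + 1 by ring, zpow_add_one₀ (by norm_num), h1]; ring
  have hq : μ (shell ⁻¹' {some m}) ≤ ENNReal.ofReal (tail μ (2 * r)) := by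
    rw [tail, ofReal_measureReal]
    refine measure_mono fun x hx => ?_
    rw [← h1]
    exact (shell_eq_some.1 hx).1
  have hs : μ (shell ⁻¹' {some m}) ^ (1 / 2 : ℝ) ≤ ENNReal.ofReal √(tail μ (2 * r)) := by
    refine (ENNReal.rpow_le_rpow hq (by norm_num)).trans_eq ?_
    rw [ENNReal.ofReal_rpow_of_nonneg (show 0 ≤ tail μ (2 * r) from measureReal_nonneg)
      (by norm_num), Real.sqrt_eq_rpow]
  have hint : ENNReal.ofReal (r ^ (p - 1) * √(tail μ (2 * r))) * ENNReal.ofReal r ≤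
      ∫⁻ t in Ioc r (2 * r), ENNReal.ofReal (t ^ (p - 1) * √(tail μ t)) := by
    calc _ = ∫⁻ _t in Ioc r (2 * r), ENNReal.ofReal (r ^ (p - 1) * √(tail μ (2 * r))) := by
          rw [setLIntegral_const, Real.volume_Ioc]
          congr 2; ring
      _ ≤ _ := by
          refine setLIntegral_mono' measurableSet_Ioc fun t ht => ENNReal.ofReal_le_ofReal ?_
          have ht0 : 0 < t := hr0.trans ht.1
          exact mul_le_mul (Real.rpow_le_rpow hr0.le ht.1.le (by linarith))
            (Real.sqrt_le_sqrt (tail_anti μ ht.2)) (Real.sqrt_nonneg _) (by positivity)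
  rw [h1]
  calc weight p (some m) * μ (shell ⁻¹' {some m}) ^ (1 / 2 : ℝ)
      ≤ ENNReal.ofReal ((4 * r) ^ p) * ENNReal.ofReal √(tail μ (2 * r)) := by
        refine mul_le_mul' ?_ hs
        rw [weight, radius, h2]
    _ = ENNReal.ofReal (4 ^ p) *
        (ENNReal.ofReal (r ^ (p - 1) * √(tail μ (2 * r))) * ENNReal.ofReal r) := by
        rw [← ENNReal.ofReal_mul (by positivity), ← ENNReal.ofReal_mul (by positivity),
          ← ENNReal.ofReal_mul (by positivity), Real.mul_rpow (by norm_num) hr0.le,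
          Real.rpow_sub_one hr0.ne']
        congr 1
        field_simp
    _ ≤ _ := by gcongr

theorem tsum_weight_mul_sqrt_le {p : ℝ} (hp : 1 ≤ p) (μ : Measure (EuclideanSpace ℝ (Fin d)))
    [IsFiniteMeasure μ] :
    ∑' σ, weight p σ * μ (shell ⁻¹' {σ}) ^ (1 / 2 : ℝ) ≤
      ENNReal.ofReal (4 ^ p) * tailIntegral p μ := by
  have h0 : Function.support (fun σ => weight p σ * μ (shell ⁻¹' {σ}) ^ (1 / 2 : ℝ)) ⊆
      range some := by
    intro σ hσ
    rcases σ with _ | m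
    · exact absurd (by simp [weight, radius, Real.zero_rpow (by linarith : p ≠ 0)]) hσ
    · exact ⟨m, rfl⟩
  rw [← (Option.some_injective ℤ).tsum_eq h0]
  refine (ENNReal.tsum_le_tsum fun m => weight_mul_sqrt_le hp μ m).trans ?_
  rw [ENNReal.tsum_mul_left]
  gcongr
  have hmono : Monotone fun m : ℤ => (2 : ℝ) ^ (m - 2) := fun a b h =>
    zpow_le_zpow_right₀ (by norm_num) (by omega)
  have hd := hmono.pairwise_disjoint_on_Ioc_succ
  have e : ∀ m : ℤ, Order.succ m - 2 = m - 1 := fun m => by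
    rw [Order.succ_eq_add_one]; ring
  simp only [e] at hd
  rw [← lintegral_iUnion (fun m => measurableSet_Ioc) hd]
  refine lintegral_mono_set (iUnion_subset fun m t ht => ?_)
  exact lt_trans (by positivity) ht.1

/-- Finiteness of the tail integral thus gives the moment condition needed in `wassersteinPow_le`.
-/
theorem tsum_weight_mul_le {p : ℝ} (μ : Measure (EuclideanSpace ℝ (Fin d)))
    [IsProbabilityMeasure μ] :
    ∑' σ, weight p σ * μ (shell ⁻¹' {σ}) ≤
      ∑' σ, weight p σ * μ (shell ⁻¹' {σ}) ^ (1 / 2 : ℝ) := by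
  refine ENNReal.tsum_le_tsum fun σ => ?_
  gcongr
  conv_lhs => rw [← ENNReal.rpow_one (μ (shell ⁻¹' {σ}))]
  exact ENNReal.rpow_le_rpow_of_exponent_ge prob_le_one (by norm_num)

end Tail

/-- The sum over all levels of the statistical errors. -/
noncomputable def levelSum (d : ℕ) (p : ℝ) (n : ℕ) : ℝ≥0∞ :=
  ∑' l, ratio p ^ l * min 1 ((grid d l).card * (n : ℝ≥0∞)⁻¹) ^ (1 / 2 : ℝ)

/-- Minkowski is applied over pairs (level, shell). The bound for each `L²` norm is a function of
the level times a function of the shell, so the double sum factors. -/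
theorem lintegral_empiricalWassersteinPow_sq_le {d n : ℕ} {Ω : Type*} [MeasurableSpace Ω]
    {P : Measure Ω} [IsProbabilityMeasure P] {μ : Measure (EuclideanSpace ℝ (Fin d))}
    [IsProbabilityMeasure μ] {X : Fin n → Ω → EuclideanSpace ℝ (Fin d)} {p : ℝ} (hp : 1 ≤ p)
    (hn : 1 ≤ n) (hX : iIndepFun X P) (hL : ∀ k, HasLaw (X k) μ P) (hI : tailIntegral p μ < ∞) :
    ∫⁻ ω, empiricalWassersteinPow p X μ ω ^ 2 ∂P ≤
      (ENNReal.ofReal ((2 * √d) ^ p) * ENNReal.ofReal (2 ^ p) * 2 * ENNReal.ofReal (4 ^ p) *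
        levelSum d p n * tailIntegral p μ) ^ 2 := by
  set A := ENNReal.ofReal ((2 * √d) ^ p) * ENNReal.ofReal (2 ^ p) with hA
  have hsum : ∑' σ, weight p σ * μ (shell ⁻¹' {σ}) ≠ ∞ :=
    (((tsum_weight_mul_le μ).trans (tsum_weight_mul_sqrt_le hp μ)).trans_lt
      (ENNReal.mul_lt_top ENNReal.ofReal_lt_top hI)).ne
  set f : ℕ × Option ℤ → Ω → ℝ≥0∞ := fun i ω =>
    A * (ratio p ^ i.1 * weight p i.2 *
      discrepancy (empiricalMeasure fun k => X k ω) μ i.1 i.2) with hf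
  have hfm : ∀ i, AEMeasurable (f i) P := fun i =>
    ((aemeasurable_discrepancy hL i.1 i.2).const_mul _).const_mul _
  have hpt : ∀ ω, empiricalWassersteinPow p X μ ω ≤ ∑' i, f i ω := by
    intro ω
    have := isProbabilityMeasure_empiricalMeasure hn fun k => X k ω
    refine (wassersteinPow_le hp _ μ hsum).trans_eq ?_
    simp only [hf]
    rw [ENNReal.tsum_mul_left, ENNReal.tsum_prod']
    simp_rw [mul_assoc, ENNReal.tsum_mul_left]
    rw [hA, mul_assoc]
  have hroot : ∀ a b : ℝ≥0∞, (a ^ 2 * b) ^ (1 / 2 : ℝ) = a * b ^ (1 / 2 : ℝ) := by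
    intro a b
    rw [ENNReal.mul_rpow_of_nonneg _ _ (by norm_num), ← ENNReal.rpow_ofNat, ← ENNReal.rpow_mul]
    norm_num
  have hterm : ∀ i, (∫⁻ ω, f i ω ^ 2 ∂P) ^ (1 / 2 : ℝ) ≤ A * 2 *
      ((ratio p ^ i.1 * min 1 ((grid d i.1).card * (n : ℝ≥0∞)⁻¹) ^ (1 / 2 : ℝ)) *
        (weight p i.2 * μ (shell ⁻¹' {i.2}) ^ (1 / 2 : ℝ))) := by
    rintro ⟨l, σ⟩
    have hD := lintegral_discrepancy_sq_le hn hX hL l σ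
    have hDm := (aemeasurable_discrepancy hL l σ).pow_const 2
    simp only [hf]
    simp_rw [← mul_assoc, mul_pow _ (discrepancy _ _ _ _)]
    rw [lintegral_const_mul'' _ hDm, hroot]
    have h2 : (∫⁻ ω, discrepancy (empiricalMeasure fun k => X k ω) μ l σ ^ 2 ∂P) ^ (1 / 2 : ℝ) ≤
        2 * (μ (shell ⁻¹' {σ}) ^ (1 / 2 : ℝ) *
          min 1 ((grid d l).card * (n : ℝ≥0∞)⁻¹) ^ (1 / 2 : ℝ)) := by
      refine (ENNReal.rpow_le_rpow hD (by norm_num)).trans_eq ?_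
      rw [show (4 : ℝ≥0∞) = 2 ^ 2 by norm_num, mul_assoc, hroot,
        ENNReal.mul_rpow_of_nonneg _ _ (by norm_num)]
    refine (mul_le_mul_right h2 _).trans_eq ?_
    ring
  calc ∫⁻ ω, empiricalWassersteinPow p X μ ω ^ 2 ∂P ≤ ∫⁻ ω, (∑' i, f i ω) ^ 2 ∂P :=
        lintegral_mono fun ω => pow_le_pow_left' (hpt ω) 2
    _ ≤ (∑' i, (∫⁻ ω, f i ω ^ 2 ∂P) ^ (1 / 2 : ℝ)) ^ 2 := lintegral_tsum_sq_le hfm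
    _ ≤ (A * 2 * (levelSum d p n *
          ∑' σ, weight p σ * μ (shell ⁻¹' {σ}) ^ (1 / 2 : ℝ))) ^ 2 := by
        refine pow_le_pow_left' ((ENNReal.tsum_le_tsum hterm).trans_eq ?_) 2
        rw [ENNReal.tsum_mul_left, ENNReal.tsum_prod', levelSum, ← ENNReal.tsum_mul_right]
        simp_rw [ENNReal.tsum_mul_left]
    _ ≤ (A * 2 * (levelSum d p n * (ENNReal.ofReal (4 ^ p) * tailIntegral p μ))) ^ 2 := by
        gcongr
        exact tsum_weight_mul_sqrt_le hp μ
    _ = _ := by ring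

end EmpiricalWasserstein

/-! ### Rates of the sum over levels. -/

namespace EmpiricalWasserstein

section Rate

theorem sqrt_card_grid_le {d n : ℕ} (hn : 1 ≤ n) (l : ℕ) :
    ((grid d l).card * (n : ℝ≥0∞)⁻¹) ^ (1 / 2 : ℝ) ≤
      ENNReal.ofReal (2 ^ d * ((2 : ℝ) ^ ((d : ℝ) / 2)) ^ l / √n) := by
  have hn0 : (0 : ℝ) < n := by exact_mod_cast hn
  have hs : ((2 : ℝ) ^ ((d : ℝ) / 2)) ^ 2 = 2 ^ d := by
    rw [← Real.rpow_natCast, ← Real.rpow_mul (by norm_num)]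
    norm_num
  have h1 : (grid d l).card * (n : ℝ≥0∞)⁻¹ ≤
      ENNReal.ofReal ((2 ^ d * ((2 : ℝ) ^ ((d : ℝ) / 2)) ^ l / √n) ^ 2) := by
    have e : (2 ^ d * ((2 : ℝ) ^ ((d : ℝ) / 2)) ^ l / √n) ^ 2 = 4 ^ d * 2 ^ (d * l) * (n : ℝ)⁻¹ := by
      have h4 : ((2 : ℝ) ^ d) ^ 2 = 4 ^ d := by rw [pow_right_comm]; norm_num
      rw [div_pow, mul_pow, Real.sq_sqrt hn0.le, pow_right_comm _ l 2, hs, ← pow_mul 2 d l, h4,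
        div_eq_mul_inv]
    rw [e, ENNReal.ofReal_mul (by positivity), ENNReal.ofReal_inv_of_pos hn0,
      ENNReal.ofReal_natCast]
    gcongr
    rw [← ENNReal.ofReal_natCast]
    refine ENNReal.ofReal_le_ofReal ?_
    exact_mod_cast card_grid_le d l
  refine (ENNReal.rpow_le_rpow h1 (by norm_num)).trans_eq ?_
  rw [ENNReal.ofReal_rpow_of_nonneg (by positivity) (by norm_num), ← Real.sqrt_eq_rpow,
    Real.sqrt_sq (by positivity)]

/-- The statistical bound is used below level `N` and the trivial bound from `N` on; `N` is left
free for each regime to choose. -/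
theorem levelSum_le {d n : ℕ} {p : ℝ} (hp : 1 ≤ p) (hn : 1 ≤ n) (N : ℕ) :
    levelSum d p n ≤ ENNReal.ofReal
      (2 ^ d * (∑ l ∈ Finset.range N, ((1 / 2 : ℝ) ^ p * 2 ^ ((d : ℝ) / 2)) ^ l) / √n +
        ((1 / 2 : ℝ) ^ p) ^ N * (1 - (1 / 2 : ℝ) ^ p)⁻¹) := by
  have hr1 : (1 / 2 : ℝ) ^ p < 1 :=
    Real.rpow_lt_one (by norm_num) (by norm_num) (by linarith)
  set r : ℝ := (1 / 2 : ℝ) ^ p with hr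
  have hr0 : 0 < r := by positivity
  have h1 : 0 < 1 - r := by linarith
  have hρ : ratio p = ENNReal.ofReal r := rfl
  set f : ℕ → ℝ≥0∞ := fun l =>
    ratio p ^ l * min 1 ((grid d l).card * (n : ℝ≥0∞)⁻¹) ^ (1 / 2 : ℝ) with hf
  have hA : ∀ l, f l ≤ ENNReal.ofReal (2 ^ d * (r * 2 ^ ((d : ℝ) / 2)) ^ l / √n) := by
    intro l
    calc f l ≤ ratio p ^ l * ENNReal.ofReal (2 ^ d * ((2 : ℝ) ^ ((d : ℝ) / 2)) ^ l / √n) := by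
          refine mul_le_mul_right ?_ _
          exact (ENNReal.rpow_le_rpow (min_le_right _ _) (by norm_num)).trans
            (sqrt_card_grid_le hn l)
      _ = _ := by
          rw [hρ, ← ENNReal.ofReal_pow hr0.le, ← ENNReal.ofReal_mul (by positivity)]
          congr 1
          rw [mul_pow]
          ring
  have hB : ∀ l, f l ≤ ratio p ^ l := fun l =>
    mul_le_of_le_one_right' ((ENNReal.rpow_le_rpow (min_le_left _ _) (by norm_num)).trans_eq
      (ENNReal.one_rpow _))
  have hsplit : levelSum d p n = ∑ l ∈ Finset.range N, f l + ∑' l, f (l + N) :=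
    (Summable.sum_add_tsum_nat_add' (f := f) (k := N) ENNReal.summable).symm
  have hB' : ∑' l, f (l + N) ≤ ENNReal.ofReal (r ^ N * (1 - r)⁻¹) := by
    calc ∑' l, f (l + N) ≤ ∑' l, ratio p ^ N * ratio p ^ l := by
          refine ENNReal.tsum_le_tsum fun l => (hB (l + N)).trans_eq ?_
          rw [pow_add, mul_comm]
      _ = _ := by
          rw [ENNReal.tsum_mul_left, ENNReal.tsum_geometric, hρ, ← ENNReal.ofReal_pow hr0.le,
            ← ENNReal.ofReal_one, ← ENNReal.ofReal_sub _ hr0.le, ← ENNReal.ofReal_inv_of_pos h1,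
            ← ENNReal.ofReal_mul (by positivity)]
  have hA' : ∑ l ∈ Finset.range N, f l ≤ ENNReal.ofReal
      (2 ^ d * (∑ l ∈ Finset.range N, (r * 2 ^ ((d : ℝ) / 2)) ^ l) / √n) := by
    rw [Finset.mul_sum, Finset.sum_div, ENNReal.ofReal_sum_of_nonneg fun l _ => by positivity]
    exact Finset.sum_le_sum fun l _ => hA l
  have h2 : 0 ≤ r ^ N * (1 - r)⁻¹ := by positivity
  rw [hsplit, ENNReal.ofReal_add (by positivity) h2]
  exact add_le_add hA' hB'

theorem exists_levelSum_le_of_gt {d : ℕ} {p : ℝ} (hp : 1 ≤ p) (h : (d : ℝ) / 2 < p) :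
    ∃ c : ℝ, 0 ≤ c ∧ ∀ n : ℕ, 1 ≤ n → levelSum d p n ≤ ENNReal.ofReal (c * (1 / √n)) := by
  set r : ℝ := (1 / 2 : ℝ) ^ p with hr
  set s : ℝ := (2 : ℝ) ^ ((d : ℝ) / 2) with hs
  have hr0 : 0 < r := by positivity
  have hs0 : 0 < s := by positivity
  have hr1 : r < 1 := Real.rpow_lt_one (by norm_num) (by norm_num) (by linarith)
  have hrs : r * s < 1 := by
    rw [hr, hs, one_div, Real.inv_rpow (by norm_num), inv_mul_lt_iff₀ (by positivity), mul_one]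
    exact Real.rpow_lt_rpow_of_exponent_lt (by norm_num) h
  have h1 : 0 < 1 - r * s := by linarith
  have h2 : 0 < 1 - r := by linarith
  refine ⟨2 ^ d * (1 - r * s)⁻¹, by positivity, fun n hn => ?_⟩
  -- The geometric ratio `r * s` is below `1`, so no truncation is needed: `N → ∞` removes the
  -- second term.
  have lim : Filter.Tendsto (fun N : ℕ => ENNReal.ofReal
      (2 ^ d * (1 - r * s)⁻¹ * (1 / √n) + r ^ N * (1 - r)⁻¹)) Filter.atTop
      (nhds (ENNReal.ofReal (2 ^ d * (1 - r * s)⁻¹ * (1 / √n) + 0 * (1 - r)⁻¹))) :=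
    (ENNReal.continuous_ofReal.tendsto _).comp
      (((tendsto_pow_atTop_nhds_zero_of_lt_one hr0.le hr1).mul_const _).const_add _)
  rw [zero_mul, add_zero] at lim
  refine ge_of_tendsto' lim fun N => (levelSum_le hp hn N).trans (ENNReal.ofReal_le_ofReal ?_)
  rw [← hr, ← hs, div_eq_mul_one_div]
  gcongr
  have hg := geom_sum_eq hrs.ne N
  rw [hg, ← neg_div_neg_eq, neg_sub, neg_sub, div_eq_mul_inv]
  refine mul_le_of_le_one_left (by positivity) ?_
  have : 0 ≤ (r * s) ^ N := by positivity
  linarith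

/-- The level beyond which the trivial bound is better. -/
theorem exists_level {d : ℕ} (hd : 1 ≤ d) {n : ℕ} (hn : 1 ≤ n) :
    ∃ N : ℕ, ((2 : ℝ) ^ ((d : ℝ) / 2)) ^ N ≤ √n ∧ √n < ((2 : ℝ) ^ ((d : ℝ) / 2)) ^ (N + 1) := by
  refine exists_nat_pow_near (by simpa using hn) (Real.one_lt_rpow (by norm_num) ?_)
  have : (1 : ℝ) ≤ d := by exact_mod_cast hd
  linarith

theorem exists_levelSum_le_of_eq {d : ℕ} (hd : 1 ≤ d) {p : ℝ} (hp : 1 ≤ p) (h : p = (d : ℝ) / 2) :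
    ∃ c : ℝ, 0 ≤ c ∧ ∀ n : ℕ, 2 ≤ n →
      levelSum d p n ≤ ENNReal.ofReal (c * (Real.log n / √n)) := by
  set r : ℝ := (1 / 2 : ℝ) ^ p with hr
  set s : ℝ := (2 : ℝ) ^ ((d : ℝ) / 2) with hs
  have hr0 : 0 < r := by positivity
  have hs0 : 0 < s := by positivity
  have hr1 : r < 1 := Real.rpow_lt_one (by norm_num) (by norm_num) (by linarith)
  have hrs : r * s = 1 := by
    rw [hr, hs, one_div, Real.inv_rpow (by norm_num), h]
    exact inv_mul_cancel₀ (by positivity)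
  have h2 : 0 < 1 - r := by linarith
  have hl2 : 0 < Real.log 2 := Real.log_pos (by norm_num)
  refine ⟨(2 ^ d * 2 + (1 - r)⁻¹) / Real.log 2, by positivity, fun n hn => ?_⟩
  have hn2 : (2 : ℝ) ≤ n := by exact_mod_cast hn
  obtain ⟨N, hN1, hN2⟩ := exists_level hd (by omega : 1 ≤ n)
  rw [← hs] at hN1 hN2
  have hsn : 0 < √(n : ℝ) := Real.sqrt_pos.2 (by linarith)
  have hlog : Real.log 2 ≤ Real.log n := Real.log_le_log (by norm_num) hn2
  have hNlog : (N : ℝ) * Real.log 2 ≤ Real.log n := by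
    have h3 := Real.log_le_log (by positivity) hN1
    rw [Real.log_pow, hs, Real.log_rpow (by norm_num), Real.log_sqrt (by linarith), ← h] at h3
    have : (N : ℝ) * Real.log 2 * 1 ≤ (N : ℝ) * Real.log 2 * p := by gcongr
    nlinarith
  refine (levelSum_le hp (by omega) (N + 1)).trans (ENNReal.ofReal_le_ofReal ?_)
  rw [← hr, ← hs, hrs]
  have hrN : r ^ (N + 1) ≤ 1 / √n := by
    have : r = s⁻¹ := eq_inv_of_mul_eq_one_left hrs
    rw [this, inv_pow, ← one_div]
    exact one_div_le_one_div_of_le hsn hN2.le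
  simp only [one_pow, Finset.sum_const, Finset.card_range, nsmul_eq_mul, mul_one]
  push_cast
  calc 2 ^ d * ((N : ℝ) + 1) / √n + r ^ (N + 1) * (1 - r)⁻¹
      ≤ 2 ^ d * (2 * (Real.log n / Real.log 2)) / √n +
        1 / √n * (1 - r)⁻¹ * (Real.log n / Real.log 2) := by
        -- For `n ≥ 2` this absorbs both the extra level in `N + 1` and the geometric tail into the
        -- logarithm.
        have a1 : 1 ≤ Real.log n / Real.log 2 := (one_le_div hl2).2 hlog
        have a2 : (N : ℝ) ≤ Real.log n / Real.log 2 := (le_div_iff₀ hl2).2 hNlog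
        refine add_le_add ?_ ?_
        · gcongr
          linarith
        · calc r ^ (N + 1) * (1 - r)⁻¹ ≤ 1 / √n * (1 - r)⁻¹ := by gcongr
            _ ≤ _ := le_mul_of_one_le_right (by positivity) a1
    _ = _ := by field_simp

theorem exists_levelSum_le_of_lt {d : ℕ} (hd : 1 ≤ d) {p : ℝ} (hp : 1 ≤ p) (h : p < (d : ℝ) / 2) :
    ∃ c : ℝ, 0 ≤ c ∧ ∀ n : ℕ, 1 ≤ n →
      levelSum d p n ≤ ENNReal.ofReal (c * (1 / (n : ℝ) ^ (p / d))) := by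
  set r : ℝ := (1 / 2 : ℝ) ^ p with hr
  set s : ℝ := (2 : ℝ) ^ ((d : ℝ) / 2) with hs
  have hd0 : (0 : ℝ) < d := by exact_mod_cast hd
  have hr0 : 0 < r := by positivity
  have hs0 : 0 < s := by positivity
  have hr1 : r < 1 := Real.rpow_lt_one (by norm_num) (by norm_num) (by linarith)
  have hrs : 1 < r * s := by
    rw [hr, hs, one_div, Real.inv_rpow (by norm_num), lt_inv_mul_iff₀ (by positivity), mul_one]
    exact Real.rpow_lt_rpow_of_exponent_lt (by norm_num) h
  have h1 : 0 < r * s - 1 := by linarith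
  have h2 : 0 < 1 - r := by linarith
  refine ⟨2 ^ d * (s / (r * s - 1)) + (1 - r)⁻¹, by positivity, fun n hn => ?_⟩
  have hn1 : (1 : ℝ) ≤ n := by exact_mod_cast hn
  obtain ⟨N, hN1, hN2⟩ := exists_level hd hn
  rw [← hs] at hN1 hN2
  have hsn : 0 < √(n : ℝ) := Real.sqrt_pos.2 (by linarith)
  have hrN : r ^ (N + 1) ≤ 1 / (n : ℝ) ^ (p / d) := by
    -- As `r = s^(-2p/d)`, the choice `√n < s^(N+1)` turns `r^(N+1)` into a power of `n`.
    have e1 : r = (s ^ (2 * p / d))⁻¹ := by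
      rw [hr, hs, one_div, Real.inv_rpow (by norm_num), ← Real.rpow_mul (by norm_num)]
      congr 2
      field_simp
    have e2 : (n : ℝ) ^ (p / d) = √n ^ (2 * p / d) := by
      rw [Real.sqrt_eq_rpow, ← Real.rpow_mul (by linarith)]
      congr 1
      field_simp
    rw [e1, inv_pow, ← one_div, e2, ← Real.rpow_natCast, ← Real.rpow_mul hs0.le, mul_comm,
      Real.rpow_mul hs0.le, Real.rpow_natCast]
    refine one_div_le_one_div_of_le (by positivity) ?_
    exact Real.rpow_le_rpow hsn.le hN2.le (by positivity)
  -- With ratio above `1` the last levels dominate; `s^N ≤ √n` then cancels the `√n` in the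
  -- denominator, leaving again `r^(N+1)`.
  have hg : ∑ l ∈ Finset.range (N + 1), (r * s) ^ l ≤ r ^ (N + 1) * (√n * s) / (r * s - 1) := by
    rw [geom_sum_eq hrs.ne']
    gcongr
    have : (r * s) ^ (N + 1) ≤ r ^ (N + 1) * (√n * s) := by
      rw [mul_pow, pow_succ s]
      gcongr
    linarith
  refine (levelSum_le hp hn (N + 1)).trans (ENNReal.ofReal_le_ofReal ?_)
  rw [← hr, ← hs]
  calc 2 ^ d * (∑ l ∈ Finset.range (N + 1), (r * s) ^ l) / √n + r ^ (N + 1) * (1 - r)⁻¹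
      ≤ 2 ^ d * (r ^ (N + 1) * (√n * s) / (r * s - 1)) / √n + r ^ (N + 1) * (1 - r)⁻¹ := by
        gcongr
    _ = (2 ^ d * (s / (r * s - 1)) + (1 - r)⁻¹) * r ^ (N + 1) := by field_simp
    _ ≤ _ := by gcongr

end Rate

end EmpiricalWasserstein

/-! ### Assembly of the rates and the constant. -/

open EmpiricalWasserstein in
theorem eLpNorm_empiricalWassersteinPow_sq_le {d n : ℕ} {Ω : Type*} [MeasurableSpace Ω]
    {P : Measure Ω} [IsProbabilityMeasure P] {μ : Measure (EuclideanSpace ℝ (Fin d))}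
    [IsProbabilityMeasure μ] {X : Fin n → Ω → EuclideanSpace ℝ (Fin d)} {p : ℝ} (hp : 1 ≤ p)
    (hn : 1 ≤ n) (hX : iIndepFun X P) (hL : ∀ k, HasLaw (X k) μ P) (hI : tailIntegral p μ < ∞)
    {c a b K : ℝ} (hc : 0 ≤ c) (ha : 0 ≤ a) (hab : a ^ 2 = b)
    (h : levelSum d p n ≤ ENNReal.ofReal (c * a))
    (hK : ((2 * √d) ^ p * 2 ^ p * 2 * 4 ^ p * c) ^ 2 ≤ K) :
    eLpNorm (empiricalWassersteinPow p X μ) 2 P ^ 2 ≤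
      K.toNNReal * ENNReal.ofReal b * tailIntegral p μ ^ 2 := by
  have e : eLpNorm (empiricalWassersteinPow p X μ) 2 P ^ 2 =
      ∫⁻ ω, empiricalWassersteinPow p X μ ω ^ 2 ∂P := by
    rw [eLpNorm_eq_lintegral_rpow_enorm_toReal (by norm_num) (by norm_num), ← ENNReal.rpow_ofNat,
      ← ENNReal.rpow_mul]
    simp
  rw [e]
  refine (lintegral_empiricalWassersteinPow_sq_le hp hn hX hL hI).trans ?_
  rw [mul_pow _ (tailIntegral p μ)]
  gcongr
  change _ ≤ ENNReal.ofReal K * _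
  calc _ ≤ (ENNReal.ofReal ((2 * √d) ^ p) * ENNReal.ofReal (2 ^ p) * 2 * ENNReal.ofReal (4 ^ p) *
        ENNReal.ofReal (c * a)) ^ 2 := by gcongr
    _ = ENNReal.ofReal (((2 * √d) ^ p * 2 ^ p * 2 * 4 ^ p * c) ^ 2) * ENNReal.ofReal b := by
        rw [← hab, ENNReal.ofReal_mul hc, ENNReal.ofReal_pow (by positivity),
          ENNReal.ofReal_pow ha, ENNReal.ofReal_mul (by positivity),
          ENNReal.ofReal_mul (by positivity), ENNReal.ofReal_mul (by positivity),
          ENNReal.ofReal_mul (by positivity), ENNReal.ofReal_ofNat]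
        ring
    _ ≤ _ := by gcongr

-- For fixed `p` and `d` only one regime occurs, so its constant serves for all three implications.
open EmpiricalWasserstein in
theorem exists_rate_constant {d : ℕ} (hd : 1 ≤ d) {p : ℝ} (hp : 1 ≤ p) :
    ∃ c : ℝ, 0 ≤ c ∧ ∀ n : ℕ, 1 ≤ n →
      ((d : ℝ) / 2 < p → levelSum d p n ≤ ENNReal.ofReal (c * (1 / √n))) ∧
      (p = (d : ℝ) / 2 → 2 ≤ n → levelSum d p n ≤ ENNReal.ofReal (c * (Real.log n / √n))) ∧
      (p < (d : ℝ) / 2 → levelSum d p n ≤ ENNReal.ofReal (c * (1 / (n : ℝ) ^ (p / d)))) := by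
  rcases lt_trichotomy p ((d : ℝ) / 2) with h | h | h
  · obtain ⟨c, hc, H⟩ := exists_levelSum_le_of_lt hd hp h
    exact ⟨c, hc, fun n hn => ⟨fun h' => absurd h' h.not_gt, fun h' => absurd h' h.ne,
      fun _ => H n hn⟩⟩
  · obtain ⟨c, hc, H⟩ := exists_levelSum_le_of_eq hd hp h
    exact ⟨c, hc, fun n _ => ⟨fun h' => absurd h h'.ne', fun _ hn => H n hn,
      fun h' => absurd h h'.ne⟩⟩
  · obtain ⟨c, hc, H⟩ := exists_levelSum_le_of_gt hp h
    exact ⟨c, hc, fun n hn => ⟨fun _ => H n hn, fun h' => absurd h' h.ne',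
      fun h' => absurd h' h.not_gt⟩⟩

theorem theorem5p2 (d : ℕ) (hd : 1 ≤ d) (p : ℝ) (hp : 1 ≤ p) :
    ∃ C : ℝ≥0, 0 < C ∧
      ∀ (Ω : Type*) [MeasurableSpace Ω] (P : Measure Ω) [IsProbabilityMeasure P]
        (μ : Measure (EuclideanSpace ℝ (Fin d))) [IsProbabilityMeasure μ]
        (n : ℕ) (_ : 1 ≤ n) (X : Fin n → Ω → EuclideanSpace ℝ (Fin d))
        (_ : iIndepFun X P) (_ : ∀ k, HasLaw (X k) μ P)
        (_ : EmpiricalWasserstein.tailIntegral p μ < ∞),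
        AEMeasurable (EmpiricalWasserstein.empiricalWassersteinPow p X μ) P ∧
        ((d : ℝ) / 2 < p →
          eLpNorm (EmpiricalWasserstein.empiricalWassersteinPow p X μ) 2 P ^ 2 ≤
            C * ENNReal.ofReal (1 / (n : ℝ)) * EmpiricalWasserstein.tailIntegral p μ ^ 2) ∧
        (p = (d : ℝ) / 2 → 2 ≤ n →
          eLpNorm (EmpiricalWasserstein.empiricalWassersteinPow p X μ) 2 P ^ 2 ≤
            C * ENNReal.ofReal (Real.log n ^ 2 / (n : ℝ)) *
              EmpiricalWasserstein.tailIntegral p μ ^ 2) ∧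
        (p < (d : ℝ) / 2 →
          eLpNorm (EmpiricalWasserstein.empiricalWassersteinPow p X μ) 2 P ^ 2 ≤
            C * ENNReal.ofReal (1 / (n : ℝ) ^ (2 * p / (d : ℝ))) *
              EmpiricalWasserstein.tailIntegral p μ ^ 2) := by
  obtain ⟨c, hc, H⟩ := exists_rate_constant hd hp
  -- The `+ 1` ensures positivity, since `c` is only known to be nonnegative.
  refine ⟨(((2 * √d) ^ p * 2 ^ p * 2 * 4 ^ p * c) ^ 2 + 1).toNNReal,
    Real.toNNReal_pos.2 (by positivity), ?_⟩
  intro Ω _ P _ μ _ n hn X hX hL hI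
  obtain ⟨H1, H2, H3⟩ := H n hn
  have hK : ((2 * √d) ^ p * 2 ^ p * 2 * 4 ^ p * c) ^ 2 ≤
    ((2 * √d) ^ p * 2 ^ p * 2 * 4 ^ p * c) ^ 2 + 1 := by linarith
  have hn0 : (0 : ℝ) ≤ n := Nat.cast_nonneg n
  refine ⟨EmpiricalWasserstein.aemeasurable_empiricalWassersteinPow hp hn hL,
    fun h => ?_, fun h hn2 => ?_, fun h => ?_⟩
  · refine eLpNorm_empiricalWassersteinPow_sq_le hp hn hX hL hI hc (by positivity) ?_ (H1 h) hK
    rw [div_pow, Real.sq_sqrt hn0, one_pow]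
  · refine eLpNorm_empiricalWassersteinPow_sq_le hp hn hX hL hI hc
      (div_nonneg (Real.log_natCast_nonneg n) (Real.sqrt_nonneg _)) ?_ (H2 h hn2) hK
    rw [div_pow, Real.sq_sqrt hn0]
  · refine eLpNorm_empiricalWassersteinPow_sq_le hp hn hX hL hI hc (by positivity) ?_ (H3 h) hK
    rw [div_pow, one_pow, ← Real.rpow_natCast, ← Real.rpow_mul hn0]
    congr 2
    push_cast
    ring
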